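/- Let $I=(0,1)$, let $L^2(I;\mathbb C)$ be the real Hilbert space with scalar product $\langle f,g\rangle_{L^2}=\operatorname{Re}\int_0^1 f\overline g\,dx$, let $\phi_k(x)=\sqrt2\sin(k\pi x)$, $k\ge1$, and let $H^3_{(0)}=D(A^{3/2})$, where $A=-\partial_{xx}^2$ with domain $H^2\cap H^1_0(I;\mathbb C)$; thus $H^3_{(0)}$ consists of the $f\in L^2(I;\mathbb C)$ with $\|f\|_{(3)}^2=\sum_{k\ge1}(k\pi)^6\left|\int_0^1 f\phi_k\,dx\right|^2<\infty$, and it is regarded as a real Hilbert space with the norm $\|\cdot\|_{(3)}$. For $\kappa\in\mathbb R$, let $\lambda_{1,\kappa}<\lambda_{2,\kappa}<\dots$ be the eigenvalues of $A_\kappa g=-g''-\pi^2g+2\kappa\phi_1^2g$ with domain $H^2\cap H^1_0(I;\mathbb R)$, let $\phi_{k,\kappa}$ be an eigenfunction of $A_\kappa$ for $\lambda_{k,\kappa}$, and let $\mathbb K=\{\kappa\in\mathbb R:\ \lambda_{k,\kappa}=0\text{ for some }k\ge1\}$. Define real vector spaces of smooth functions by $\mathcal H_0=\operatorname{span}_{\mathbb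 R}\{\phi_1,\ \cos(\pi x)\,\phi_1\}$, $$\mathcal H_j=\operatorname{span}_{\mathbb R}\left\{f+i\left(-g''-\pi^2g+2\kappa\phi_1^2\operatorname{Re}g\right):\ f,g\in\mathcal H_{j-1}\right\}\quad(j\ge1),\qquad \mathcal H_\infty=\bigcup_{j\ge0}\mathcal H_j$$ (that is, $Q=(\mathbf 1,\cos\pi x)$, $V=0$, $W=2\kappa\phi_1^2$). Corollary 3.4. Let $\kappa\in\mathbb K\setminus\{0\}$. Then $\mathcal H_\infty\subset H^3_{(0)}$, and the closure of $\mathcal H_\infty$ in $H^3_{(0)}$ has real codimension exactly one in $H^3_{(0)}$. Moreover, if $k\ge1$ is the index with $\lambda_{k,\kappa}=0$, then $i\phi_{k,\kappa}\in H^3_{(0)}$ and $$\{z\in H^3_{(0)}:\ \langle z,h\rangle_{L^2}=0\ \text{ for all } h\in\mathcal H_\infty\}=\mathbb R\, i\phi_{k,\kappa}.$$ -/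

import Mathlib

open MeasureTheory Set
open scoped ContDiff

namespace NLS

noncomputable section

/-- Lebesgue measure on the interval `I = (0, 1)`. -/
def muI : Measure ℝ := volume.restrict (Ioo (0 : ℝ) 1)

instance : IsFiniteMeasure muI := by
  unfold muI; infer_instance

/-- `L²(I; ℂ)`. -/
abbrev L2I : Type := Lp ℂ 2 muI

/-- The real scalar product `⟨f, g⟩_{L²} = Re ∫₀¹ f(x) conj(g(x)) dx`
(see `l2Inner_eq_integral`). -/
def l2Inner (f g : L2I) : ℝ := (inner ℂ g f).re

theorem l2Inner_eq_integral (f g : L2I) :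
    l2Inner f g = (∫ x, f x * (starRingEnd ℂ) (g x) ∂muI).re := by
  simp only [l2Inner, L2.inner_def, RCLike.inner_apply]

/-- The eigenfunctions `φ_k(x) = √2 sin(kπx)`, `k ≥ 1`, of the Dirichlet Laplacian on `I`; the
eigenvalue of `φ_k` is `k²π²`. -/
def phi (k : ℕ) (x : ℝ) : ℝ := Real.sqrt 2 * Real.sin (k * Real.pi * x)

theorem memLp_phi (k : ℕ) : MemLp (fun x => (phi k x : ℂ)) 2 muI := by
  refine MemLp.of_bound (C := Real.sqrt 2) ?_ (Filter.Eventually.of_forall fun x => ?_)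
  · unfold phi
    exact (by fun_prop : Continuous fun x : ℝ =>
      ((Real.sqrt 2 * Real.sin (k * Real.pi * x) : ℝ) : ℂ)).aestronglyMeasurable
  · rw [Complex.norm_real, phi, norm_mul, Real.norm_of_nonneg (Real.sqrt_nonneg 2)]
    exact mul_le_of_le_one_right (Real.sqrt_nonneg 2) (Real.abs_sin_le_one _)

/-- `φ_k` as an element of `L²(I; ℂ)`. -/
def phiL2 (k : ℕ) : L2I := (memLp_phi k).toLp _

/-- The complex coefficient `∫₀¹ φ_k(x) f(x) dx` (the inner product of Mathlib is conjugate linear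
in its first argument, and `φ_k` is real-valued). -/
def sineCoeff (k : ℕ) (f : L2I) : ℂ := inner ℂ (phiL2 k) f

/-- The coefficients of `A^{3/2} f` in the basis `φ_1, φ_2, …`, with `A` the Dirichlet Laplacian:
entry `n` is `(kπ)³ ∫₀¹ φ_k f` for `k = n + 1`. -/
def threeHalvesCoeff (f : L2I) (n : ℕ) : ℂ :=
  ((((n + 1 : ℕ) : ℝ) * Real.pi) ^ 3 : ℝ) • sineCoeff (n + 1) f

theorem threeHalvesCoeff_add (f g : L2I) :
    threeHalvesCoeff (f + g) = threeHalvesCoeff f + threeHalvesCoeff g := by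
  funext n
  simp only [threeHalvesCoeff, sineCoeff, inner_add_right, smul_add, Pi.add_apply]

theorem threeHalvesCoeff_smul (c : ℝ) (f : L2I) :
    threeHalvesCoeff (c • f) = c • threeHalvesCoeff f := by
  funext n
  have h : inner ℂ (phiL2 (n + 1)) (c • f) = (c : ℂ) * inner ℂ (phiL2 (n + 1)) f := by
    rw [← inner_smul_right]
    congr 1
  simp only [threeHalvesCoeff, sineCoeff, h, Pi.smul_apply, Complex.real_smul]
  ring

/-- `H³_(0) = D(A^{3/2})` as a real linear subspace of `L²(I; ℂ)`: those `f` for which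
`∑_k (kπ)⁶ |⟨f, φ_k⟩|²` is finite. -/
def H3Submodule : Submodule ℝ L2I where
  carrier := {f | Memℓp (threeHalvesCoeff f) 2}
  zero_mem' := by
    have h : threeHalvesCoeff 0 = 0 := by
      funext n
      simp [threeHalvesCoeff, sineCoeff]
    change Memℓp (threeHalvesCoeff 0) 2
    rw [h]
    exact zero_memℓp
  add_mem' := by
    intro f g hf hg
    change Memℓp (threeHalvesCoeff (f + g)) 2
    rw [threeHalvesCoeff_add]
    exact Memℓp.add hf hg
  smul_mem' := by
    intro c f hf
    change Memℓp (threeHalvesCoeff (c • f)) 2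
    rw [threeHalvesCoeff_smul]
    exact Memℓp.const_smul hf c

/-- The space `H³_(0)`. It is a type of its own because it carries the topology of the norm
`‖f‖_(3) = ‖A^{3/2} f‖_{L²}`, not the one of `L²`. -/
def H3 : Type := ↥H3Submodule

instance : AddCommGroup H3 := inferInstanceAs (AddCommGroup ↥H3Submodule)

instance : Module ℝ H3 := inferInstanceAs (Module ℝ ↥H3Submodule)

/-- The inclusion of `H³_(0)` in `L²(I; ℂ)`. -/
def H3.toL2 : H3 →ₗ[ℝ] L2I := H3Submodule.subtype

/-- `f ↦ A^{3/2} f`, with values in `ℓ²` through the basis `φ_1, φ_2, …`. -/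
def H3.threeHalves : H3 →ₗ[ℝ] lp (fun _ : ℕ => ℂ) 2 where
  toFun f := ⟨threeHalvesCoeff (H3.toL2 f), f.2⟩
  map_add' f g := by
    apply Subtype.ext
    change threeHalvesCoeff (H3.toL2 (f + g)) = _
    rw [map_add, threeHalvesCoeff_add]
    rfl
  map_smul' c f := by
    apply Subtype.ext
    change threeHalvesCoeff (H3.toL2 (c • f)) = _
    rw [map_smul, threeHalvesCoeff_smul]
    rfl

/-- `‖f‖_(3) = ‖A^{3/2} f‖ = (∑_k (kπ)⁶ |⟨f, φ_k⟩|²)^{1/2}`. -/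
instance : SeminormedAddCommGroup H3 :=
  SeminormedAddCommGroup.induced H3 (lp (fun _ : ℕ => ℂ) 2) H3.threeHalves

instance : NormedSpace ℝ H3 :=
  NormedSpace.induced ℝ H3 (lp (fun _ : ℕ => ℂ) 2) H3.threeHalves

/-- `g ↦ i (-∂ₓ² g + V g - λ g + W Re g)`, for smooth `g`. -/
def linOp (V W : ℝ → ℝ) (lam : ℝ) (g : ℝ → ℂ) : ℝ → ℂ := fun x =>
  Complex.I * (-(deriv (deriv g) x) + V x * g x - lam * g x + W x * ((g x).re : ℂ))

/-- `ℱ(H) = span_ℝ {f + i (-∂ₓ² g + V g - λ g + W Re g) : f, g ∈ H}`. -/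
def extend (V W : ℝ → ℝ) (lam : ℝ) (H : Submodule ℝ (ℝ → ℂ)) : Submodule ℝ (ℝ → ℂ) :=
  Submodule.span ℝ {h | ∃ f ∈ H, ∃ g ∈ H, h = f + linOp V W lam g}

/-- The spaces `H_0 = span_ℝ {Q_j φ}` and `H_j = ℱ(H_{j-1})`. -/
def satSpace {q : ℕ} (Q : Fin q → ℝ → ℝ) (V W ph : ℝ → ℝ) (lam : ℝ) :
    ℕ → Submodule ℝ (ℝ → ℂ)
  | 0 => Submodule.span ℝ (Set.range fun j : Fin q => fun x => ((Q j x * ph x : ℝ) : ℂ))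
  | n + 1 => extend V W lam (satSpace Q V W ph lam n)

theorem satSpace_mono {q : ℕ} (Q : Fin q → ℝ → ℝ) (V W ph : ℝ → ℝ) (lam : ℝ) :
    Monotone (satSpace Q V W ph lam) := by
  refine monotone_nat_of_le_succ fun n f hf => Submodule.subset_span ?_
  refine ⟨f, hf, 0, Submodule.zero_mem _, ?_⟩
  have h : deriv (0 : ℝ → ℂ) = 0 := deriv_const' 0
  funext x
  simp [linOp, h]

/-- `H_∞ = ⋃_j H_j`; see `mem_satSpaceInf`. -/
def satSpaceInf {q : ℕ} (Q : Fin q → ℝ → ℝ) (V W ph : ℝ → ℝ) (lam : ℝ) :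
    Submodule ℝ (ℝ → ℂ) :=
  ⨆ n, satSpace Q V W ph lam n

theorem mem_satSpaceInf {q : ℕ} (Q : Fin q → ℝ → ℝ) (V W ph : ℝ → ℝ) (lam : ℝ) (f : ℝ → ℂ) :
    f ∈ satSpaceInf Q V W ph lam ↔ ∃ n, f ∈ satSpace Q V W ph lam n :=
  Submodule.mem_iSup_of_directed _ (satSpace_mono Q V W ph lam).directed_le

/-- `H_∞` for `Q = (1, cos πx)`, `V = 0`, `W = 2κφ_1²`; the ground state of `-∂ₓ²` is `φ_1`, with
eigenvalue `π²`. -/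
def Hinf (κ : ℝ) : Submodule ℝ (ℝ → ℂ) :=
  satSpaceInf ![fun _ => 1, fun x => Real.cos (Real.pi * x)] (fun _ => 0)
    (fun x => 2 * κ * phi 1 x ^ 2) (phi 1) (Real.pi ^ 2)

/-- The elements of `H³_(0)` that agree almost everywhere on `I` with an element of `S`. -/
def inH3 (S : Submodule ℝ (ℝ → ℂ)) : Submodule ℝ H3 where
  carrier := {f | ∃ h ∈ S, ⇑(H3.toL2 f) =ᵐ[muI] h}
  zero_mem' := by
    refine ⟨0, S.zero_mem, ?_⟩
    rw [map_zero]
    exact Lp.coeFn_zero ℂ 2 muI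
  add_mem' := by
    rintro f g ⟨a, ha, hfa⟩ ⟨b, hb, hgb⟩
    refine ⟨a + b, S.add_mem ha hb, ?_⟩
    rw [map_add]
    exact (Lp.coeFn_add _ _).trans (hfa.add hgb)
  smul_mem' := by
    rintro c f ⟨a, ha, hfa⟩
    refine ⟨c • a, S.smul_mem c ha, ?_⟩
    rw [map_smul]
    exact (Lp.coeFn_smul c _).trans (hfa.const_smul c)

/-- Test functions: smooth, with compact support in `I`. -/
def IsTest (η : ℝ → ℝ) : Prop :=
  ContDiff ℝ ∞ η ∧ HasCompactSupport η ∧ tsupport η ⊆ Ioo (0 : ℝ) 1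

/-- `g` is the weak derivative of `f` on `I` (used for `f, g ∈ L²(I; ℝ)`). -/
def HasWeakDeriv (f g : ℝ → ℝ) : Prop :=
  ∀ η, IsTest η → ∫ x, f x * deriv η x ∂muI = -∫ x, g x * η x ∂muI

/-- `u ∈ H² ∩ H¹_0(I; ℝ)`, with weak derivatives `u' = u1` and `u'' = u2`. The last condition says
that `u` is in `H¹_0`, the closure of the test functions in `H¹`. -/
structure InDomain (u u1 u2 : ℝ → ℝ) : Prop where
  memLp : MemLp u 2 muI
  memLp_one : MemLp u1 2 muI
  memLp_two : MemLp u2 2 muI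
  weak_one : HasWeakDeriv u u1
  weak_two : HasWeakDeriv u1 u2
  dirichlet : ∀ ε : ENNReal, 0 < ε → ∃ η, IsTest η ∧
    eLpNorm (u - η) 2 muI < ε ∧ eLpNorm (u1 - deriv η) 2 muI < ε

/-- `u` is an eigenfunction, with eigenvalue `μ`, of `A_κ = -∂ₓ² - π² + 2κφ_1²` with domain
`H² ∩ H¹_0(I; ℝ)`. -/
def IsEigenfunction (κ μ : ℝ) (u : ℝ → ℝ) : Prop :=
  ¬ u =ᵐ[muI] 0 ∧ ∃ u1 u2, InDomain u u1 u2 ∧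
    ∀ᵐ x ∂muI, -u2 x - Real.pi ^ 2 * u x + 2 * κ * phi 1 x ^ 2 * u x = μ * u x

/-- The set of eigenvalues of `A_κ`. -/
def eigenvalues (κ : ℝ) : Set ℝ := {μ | ∃ u, IsEigenfunction κ μ u}

/-- `μ = λ_{k,κ}`, where `λ_{1,κ} < λ_{2,κ} < …` are the eigenvalues of `A_κ`: `μ` is an eigenvalue
and exactly `k - 1` eigenvalues are smaller. In particular `k ≥ 1`. -/
def IsKthEigenvalue (κ : ℝ) (k : ℕ) (μ : ℝ) : Prop :=
  μ ∈ eigenvalues κ ∧ (eigenvalues κ ∩ Iio μ).encard + 1 = k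

/-- The exceptional set `𝕂` of those `κ` for which some `λ_{k,κ}`, `k ≥ 1`, vanishes. -/
def exceptionalSet : Set ℝ := {κ | ∃ k : ℕ, IsKthEigenvalue κ k 0}

end

end NLS

/-! In the sine basis the operator `-∂ₓ² - π² + 2κφ_1²` is a Jacobi operator with steps of length
two, because `2φ_1² φ_k = 2φ_k - φ_{k+2} - φ_{k-2}`; negative indices are covered by `φ_{-k} =
-φ_k`. The operator `linOp` maps `φ_k` to `i` times this Jacobi combination, and it maps `i φ_k` to
a real multiple of `φ_k`, since the potential sees only the real part. Applied twice to `φ_k`, it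
reaches `φ_{k+2}` with a coefficient proportional to `κ`. So for `κ ≠ 0` the space `Hinf κ` is
exactly the span of all `φ_k` and all `i A_κ φ_k` (`Hinf_eq_sineSpan`).

A continuous functional on `H³_(0)` that kills this span is zero at every `φ_k`, and its values
`c_k` at `i φ_k` solve the homogeneous recurrence. Continuity gives at most cubic growth of `c`.
Solving the recurrence for `k² c_k` gains two powers of decay at a time (`rapid_decay`), so `u = ∑
c_k φ_k` is a classical solution of `-u'' - π² u + 2κφ_1² u = 0` with `u(0) = 0`. Such a solution is
determined by `u'(0)`, so the sequences `c` form a space of dimension at most one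
(`solution_proportional`).

An eigenfunction for the eigenvalue `0` supplies a nonzero sequence
(`IsEigenfunction.jacobi_eq_zero`, together with completeness of the sines). Its decay puts `i`
times the eigenfunction in `H³_(0)` and yields a functional `L` with these values. By Hahn–Banach
the closure of the span is `ker L` (`topologicalClosure_sineSpanH3`), of codimension one.
`L²`-orthogonality to the span is the same recurrence for the imaginary parts of the sine
coefficients, which gives the orthogonal complement. -/

namespace NLS

/-! ### The Jacobi recurrence and the decay of its solutions -/

section Jacobi

variable {V W : Type*} [AddCommGroup V] [Module ℝ V] [AddCommGroup W] [Module ℝ W]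

/-- The sequence `k ↦ v (k - 2)`, where `v` is extended to negative indices as an odd sequence. -/
def shiftBack (v : ℕ → V) : ℕ → V
  | 0 => -v 2
  | 1 => -v 1
  | k + 2 => v k

/-- The Jacobi operator that represents `-∂ₓ² - π² + 2κφ_1²` in the basis `φ_1, φ_2, …`. -/
noncomputable def jacobi (κ : ℝ) (v : ℕ → V) (k : ℕ) : V :=
  (((k : ℝ) ^ 2 - 1) * Real.pi ^ 2 + 2 * κ) • v k - κ • (v (k + 2) + shiftBack v k)

theorem map_shiftBack (T : V →ₗ[ℝ] W) (v : ℕ → V) (k : ℕ) :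
    T (shiftBack v k) = shiftBack (fun j => T (v j)) k := by
  match k with
  | 0 => simp [shiftBack]
  | 1 => simp [shiftBack]
  | k + 2 => simp [shiftBack]

/-- The recurrence is used for numbers, functions, elements of `H³_(0)` and pairs of these;
evaluations, projections and functionals carry one version to another. -/
theorem map_jacobi (T : V →ₗ[ℝ] W) (κ : ℝ) (v : ℕ → V) (k : ℕ) :
    T (jacobi κ v k) = jacobi κ (fun j => T (v j)) k := by
  simp only [jacobi, map_sub, map_smul, map_add, map_shiftBack]

theorem shiftBack_mem (S : Submodule ℝ V) {v : ℕ → V} (h : ∀ k, v k ∈ S) (k : ℕ) :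
    shiftBack v k ∈ S := by
  match k with
  | 0 => exact S.neg_mem (h 2)
  | 1 => exact S.neg_mem (h 1)
  | k + 2 => exact h k

theorem jacobi_mem (S : Submodule ℝ V) {κ : ℝ} {v : ℕ → V} (h : ∀ k, v k ∈ S) (k : ℕ) :
    jacobi κ v k ∈ S :=
  S.sub_mem (S.smul_mem _ (h k)) (S.smul_mem _ (S.add_mem (h _) (shiftBack_mem S h k)))

end Jacobi

/-- One step of the decay of solutions of the recurrence: two powers of `k` are gained. -/
theorem decay_step {κ : ℝ} {c : ℕ → ℝ} (hc : ∀ k, jacobi κ c k = 0) (m : ℕ)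
    (h : ∃ C, ∀ k : ℕ, ((k : ℝ) + 1) ^ m * |c k| ≤ C * ((k : ℝ) + 1) ^ 3) :
    ∃ C, ∀ k : ℕ, ((k : ℝ) + 1) ^ (m + 2) * |c k| ≤ C * ((k : ℝ) + 1) ^ 3 := by
  obtain ⟨C, hC⟩ := h
  have hC0 : 0 ≤ C := by have := hC 0; simp at this; exact (abs_nonneg _).trans this
  have h2 : ∀ k : ℕ, ((k : ℝ) + 1) ^ m * |c (k + 2)| ≤ 27 * C * ((k : ℝ) + 1) ^ 3 := by
    intro k
    have hk : (0 : ℝ) ≤ k := k.cast_nonneg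
    have := hC (k + 2)
    push_cast at this
    calc ((k : ℝ) + 1) ^ m * |c (k + 2)| ≤ ((k : ℝ) + 2 + 1) ^ m * |c (k + 2)| := by
          gcongr; linarith
      _ ≤ C * ((k : ℝ) + 2 + 1) ^ 3 := this
      _ ≤ C * (3 * ((k : ℝ) + 1)) ^ 3 := by gcongr; linarith
      _ = _ := by ring
  have h3 : ∃ D, ∀ k : ℕ, ((k : ℝ) + 1) ^ m * |shiftBack c k| ≤ D * ((k : ℝ) + 1) ^ 3 := by
    -- One summand for each case of `shiftBack`: index `0` sees `c 2`, index `1` sees `c 1`, and for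
    -- `k + 2` the weight satisfies `(k + 3)^m ≤ 3^m (k + 1)^m`.
    refine ⟨27 * C + C + 3 ^ m * C, fun k => ?_⟩
    have h3m : (0 : ℝ) ≤ 3 ^ m * C := by positivity
    match k with
    | 0 =>
      have := h2 0
      simp [shiftBack] at this ⊢
      linarith
    | 1 =>
      have := hC 1
      simp only [shiftBack, abs_neg]
      refine this.trans ?_
      gcongr
      linarith
    | k + 2 =>
      have hk : (0 : ℝ) ≤ k := k.cast_nonneg
      simp only [shiftBack]
      push_cast
      calc ((k : ℝ) + 2 + 1) ^ m * |c k| ≤ (3 * ((k : ℝ) + 1)) ^ m * |c k| := by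
            gcongr; linarith
        _ = 3 ^ m * (((k : ℝ) + 1) ^ m * |c k|) := by rw [mul_pow]; ring
        _ ≤ 3 ^ m * (C * ((k : ℝ) + 1) ^ 3) :=
          mul_le_mul_of_nonneg_left (hC k) (by positivity)
        _ ≤ 3 ^ m * (C * ((k : ℝ) + 2 + 1) ^ 3) := by gcongr; linarith
        _ = (0 + 3 ^ m * C) * ((k : ℝ) + 2 + 1) ^ 3 := by ring
        _ ≤ _ := by gcongr; linarith
  obtain ⟨D, hD⟩ := h3
  -- The recurrence is solved for `k² π² c_k`; the factor `2` and the summand `1` come from `(k +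
  -- 1)² ≤ 2k² + 2`, and `π² ≥ 1` removes `π²` on the left.
  set A : ℝ := 2 * (1 + Real.pi ^ 2 + 2 * |κ|) with hA
  have key : ∀ k : ℕ, ((k : ℝ) + 1) ^ 2 * |c k| ≤
      A * (|c k| + |c (k + 2)| + |shiftBack c k|) := by
    intro k
    have e : ((k : ℝ) ^ 2 * Real.pi ^ 2) * c k =
        (Real.pi ^ 2 - 2 * κ) * c k + κ * (c (k + 2) + shiftBack c k) := by
      have := hc k
      simp only [jacobi, smul_eq_mul] at this
      linarith
    have e2 : ((k : ℝ) ^ 2 * Real.pi ^ 2) * |c k| ≤ (Real.pi ^ 2 + 2 * |κ|) * |c k| +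
        |κ| * (|c (k + 2)| + |shiftBack c k|) := by
      calc ((k : ℝ) ^ 2 * Real.pi ^ 2) * |c k| = |((k : ℝ) ^ 2 * Real.pi ^ 2) * c k| := by
            rw [abs_mul, abs_of_nonneg (a := (k : ℝ) ^ 2 * Real.pi ^ 2) (by positivity)]
        _ ≤ |Real.pi ^ 2 - 2 * κ| * |c k| + |κ| * |c (k + 2) + shiftBack c k| := by
            rw [e, ← abs_mul, ← abs_mul]; exact abs_add_le _ _
        _ ≤ _ := by
            gcongr
            · refine (abs_sub _ _).trans ?_
              rw [abs_mul, abs_two, abs_of_nonneg (a := Real.pi ^ 2) (by positivity)]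
            · exact abs_add_le _ _
    have hpi : (1 : ℝ) ≤ Real.pi ^ 2 := by nlinarith [Real.pi_gt_three]
    have e3 : (k : ℝ) ^ 2 * |c k| ≤ ((k : ℝ) ^ 2 * Real.pi ^ 2) * |c k| := by
      gcongr; exact le_mul_of_one_le_right (by positivity) hpi
    have e4 : ((k : ℝ) + 1) ^ 2 * |c k| ≤ (2 * (k : ℝ) ^ 2 + 2) * |c k| := by
      gcongr; nlinarith [sq_nonneg ((k : ℝ) - 1)]
    have e5 : |κ| * (|c (k + 2)| + |shiftBack c k|) ≤
        (1 + Real.pi ^ 2 + 2 * |κ|) * (|c (k + 2)| + |shiftBack c k|) := by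
      gcongr; nlinarith [abs_nonneg κ, sq_nonneg Real.pi]
    rw [hA]
    linarith
  refine ⟨A * (C + 27 * C + D), fun k => ?_⟩
  have hA0 : 0 ≤ A := by positivity
  calc ((k : ℝ) + 1) ^ (m + 2) * |c k| = ((k : ℝ) + 1) ^ m * (((k : ℝ) + 1) ^ 2 * |c k|) := by ring
    _ ≤ ((k : ℝ) + 1) ^ m * (A * (|c k| + |c (k + 2)| + |shiftBack c k|)) :=
        mul_le_mul_of_nonneg_left (key k) (by positivity)
    _ = A * (((k : ℝ) + 1) ^ m * |c k| + ((k : ℝ) + 1) ^ m * |c (k + 2)| +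
          ((k : ℝ) + 1) ^ m * |shiftBack c k|) := by ring
    _ ≤ A * (C * ((k : ℝ) + 1) ^ 3 + 27 * C * ((k : ℝ) + 1) ^ 3 + D * ((k : ℝ) + 1) ^ 3) :=
        mul_le_mul_of_nonneg_left (add_le_add (add_le_add (hC k) (h2 k)) (hD k)) hA0
    _ = _ := by ring

/-- A solution of the recurrence that grows at most like `k³` decays faster than `k⁻⁴`. -/
theorem rapid_decay {κ : ℝ} {c : ℕ → ℝ} (hc : ∀ k, jacobi κ c k = 0)
    (h : ∃ C, ∀ k : ℕ, |c k| ≤ C * ((k : ℝ) + 1) ^ 3) :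
    ∃ C, ∀ k : ℕ, ((k : ℝ) + 1) ^ 5 * |c k| ≤ C := by
  -- Four steps raise the weight from `0` to `8`; dividing by the cubic growth leaves `5`.
  have h8 : ∃ C, ∀ k : ℕ, ((k : ℝ) + 1) ^ 8 * |c k| ≤ C * ((k : ℝ) + 1) ^ 3 :=
    decay_step hc 6 (decay_step hc 4 (decay_step hc 2 (decay_step hc 0 (by simpa using h))))
  obtain ⟨C, hC⟩ := h8
  refine ⟨C, fun k => ?_⟩
  have hk : (0 : ℝ) < ((k : ℝ) + 1) ^ 3 := by positivity
  refine le_of_mul_le_mul_right ?_ hk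
  calc _ = ((k : ℝ) + 1) ^ 8 * |c k| := by ring
    _ ≤ _ := hC k

/-! ### The sine functions and the action of the operator on them -/

theorem phi_zero (x : ℝ) : phi 0 x = 0 := by simp [phi]

theorem contDiff_phi (k : ℕ) : ContDiff ℝ ∞ (phi k) := by
  unfold phi; fun_prop

theorem hasDerivAt_phi (k : ℕ) (x : ℝ) :
    HasDerivAt (phi k) (Real.sqrt 2 * (k * Real.pi) * Real.cos (k * Real.pi * x)) x := by
  have h : HasDerivAt (fun x : ℝ => k * Real.pi * x) (k * Real.pi) x := by
    simpa using (hasDerivAt_id x).const_mul (k * Real.pi)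
  convert! (h.sin).const_mul (Real.sqrt 2) using 1
  ring

theorem hasDerivAt_deriv_phi (k : ℕ) (x : ℝ) :
    HasDerivAt (fun x => Real.sqrt 2 * (k * Real.pi) * Real.cos (k * Real.pi * x))
      (-(k * Real.pi) ^ 2 * phi k x) x := by
  have h : HasDerivAt (fun x : ℝ => k * Real.pi * x) (k * Real.pi) x := by
    simpa using (hasDerivAt_id x).const_mul (k * Real.pi)
  convert! (h.cos).const_mul (Real.sqrt 2 * (k * Real.pi)) using 1
  simp only [phi]; ring

/-- This is `φ_1² = 1 - cos 2πx` and the product formula for `cos 2πx · sin kπx`. For `k = 0, 1` the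
index `k - 2` is negative, and oddness of the sine in `k` matches the odd extension in `shiftBack`.
-/
theorem phi_one_sq_mul (k : ℕ) (x : ℝ) :
    2 * phi 1 x ^ 2 * phi k x =
      2 * phi k x - (phi (k + 2) x + shiftBack (fun j => phi j x) k) := by
  have h2 : Real.sqrt 2 ^ 2 = 2 := Real.sq_sqrt (by norm_num)
  have key : ∀ t : ℝ, phi 1 x ^ 2 * Real.sin t =
      Real.sin t - (Real.sin (t + 2 * (Real.pi * x)) + Real.sin (t - 2 * (Real.pi * x))) / 2 := by
    intro t
    rw [Real.sin_add, Real.sin_sub, Real.cos_two_mul, phi, mul_pow, h2, Nat.cast_one, one_mul,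
      Real.sin_sq]
    ring
  have hb : shiftBack (fun j => phi j x) k =
      Real.sqrt 2 * Real.sin (k * Real.pi * x - 2 * (Real.pi * x)) := by
    match k with
    | 0 => simp [shiftBack, phi, mul_assoc]
    | 1 =>
      simp only [shiftBack, phi, Nat.cast_one, one_mul]
      rw [show Real.pi * x - 2 * (Real.pi * x) = -(Real.pi * x) by ring, Real.sin_neg]; ring
    | k + 2 =>
      simp only [shiftBack, phi, Nat.cast_add, Nat.cast_ofNat]
      congr 2; ring
  have hf : phi (k + 2) x = Real.sqrt 2 * Real.sin (k * Real.pi * x + 2 * (Real.pi * x)) := by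
    simp only [phi, Nat.cast_add, Nat.cast_ofNat]
    congr 2; ring
  rw [hb, hf]
  have := key (k * Real.pi * x)
  rw [show 2 * phi 1 x ^ 2 * phi k x =
    2 * Real.sqrt 2 * (phi 1 x ^ 2 * Real.sin (k * Real.pi * x)) by simp only [phi]; ring, this,
    show phi k x = Real.sqrt 2 * Real.sin (k * Real.pi * x) from rfl]
  ring

/-- The action of `-∂ₓ² - π² + 2κφ_1²` on `φ_k`. -/
theorem operator_phi (κ : ℝ) (k : ℕ) (x : ℝ) :
    ((k : ℝ) * Real.pi) ^ 2 * phi k x - Real.pi ^ 2 * phi k x + 2 * κ * phi 1 x ^ 2 * phi k x =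
      jacobi κ (fun j => phi j x) k := by
  have := phi_one_sq_mul k x
  simp only [jacobi, smul_eq_mul]
  linear_combination κ * this

theorem integral_cos_int_mul_pi {n : ℤ} (hn : n ≠ 0) :
    ∫ x in (0 : ℝ)..1, Real.cos (n * Real.pi * x) = 0 := by
  have h : ((n : ℝ) * Real.pi) ≠ 0 := by
    simp [hn, Real.pi_ne_zero]
  rw [intervalIntegral.integral_comp_mul_left (fun y => Real.cos y) h]
  simp [Real.sin_int_mul_pi]

theorem integral_muI {E : Type*} [NormedAddCommGroup E] [NormedSpace ℝ E] (f : ℝ → E) :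
    ∫ x, f x ∂muI = ∫ x in (0 : ℝ)..1, f x := by
  rw [intervalIntegral.integral_of_le zero_le_one, muI, integral_Ioc_eq_integral_Ioo]

theorem integral_phi_mul_phi (j k : ℕ) :
    ∫ x, phi j x * phi k x ∂muI = if j = k ∧ k ≠ 0 then 1 else 0 := by
  rw [integral_muI]
  rcases eq_or_ne k 0 with rfl | hk
  · simp [phi_zero]
  have e : ∀ x, phi j x * phi k x =
      Real.cos (((j : ℤ) - k : ℤ) * Real.pi * x) - Real.cos (((j : ℤ) + k : ℤ) * Real.pi * x) := by
    intro x
    have h2 : Real.sqrt 2 * Real.sqrt 2 = 2 := Real.mul_self_sqrt (by norm_num)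
    push_cast
    rw [show ((j : ℝ) - k) * Real.pi * x = j * Real.pi * x - k * Real.pi * x by ring,
      show ((j : ℝ) + k) * Real.pi * x = j * Real.pi * x + k * Real.pi * x by ring,
      Real.cos_sub, Real.cos_add]
    simp only [phi]
    linear_combination (Real.sin (j * Real.pi * x) * Real.sin (k * Real.pi * x)) * h2
  simp only [e]
  rw [intervalIntegral.integral_sub (Continuous.intervalIntegrable (by fun_prop) _ _)
    (Continuous.intervalIntegrable (by fun_prop) _ _)]
  · rw [integral_cos_int_mul_pi (n := (j : ℤ) + k) (by omega)]
    rcases eq_or_ne j k with rfl | hjk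
    · simp [hk]
    · rw [integral_cos_int_mul_pi (by omega)]
      simp [hjk]

theorem abs_phi_le (k : ℕ) (x : ℝ) : |phi k x| ≤ Real.sqrt 2 := by
  rw [phi, abs_mul, abs_of_nonneg (Real.sqrt_nonneg 2)]
  exact mul_le_of_le_one_right (Real.sqrt_nonneg 2) (Real.abs_sin_le_one _)

/-- Summation by parts for the Jacobi operator. -/
theorem tsum_mul_jacobi {κ : ℝ} {c p : ℕ → ℝ} (hc0 : c 0 = 0) (hp0 : p 0 = 0)
    (h0 : Summable fun k : ℕ => c k * p k) (h2 : Summable fun k : ℕ => (k : ℝ) ^ 2 * (c k * p k))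
    (hf : Summable fun k => c k * p (k + 2)) (hb : Summable fun k => c (k + 2) * p k) :
    HasSum (fun k => c k * jacobi κ p k) (∑' k, jacobi κ c k * p k) := by
  have shift : ∀ a b : ℕ → ℝ, b 0 = 0 → (Summable fun k => a (k + 2) * b k) →
      HasSum (fun k => a k * shiftBack b k) (-(a 1 * b 1) - a 0 * b 2 + ∑' k, a (k + 2) * b k) := by
    intro a b hb0 hs
    rw [← hasSum_nat_add_iff' 2]
    simp only [shiftBack, Finset.sum_range_succ, Finset.range_zero, Finset.sum_empty]
    convert! hs.hasSum using 1
    ring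
  have hA := shift c p hp0 hb
  have hB := shift p c hc0 (by simpa only [mul_comm] using hf)
  -- Both shifts now leave the same boundary term `-(c 1 * p 1)`, so it cancels in the comparison:
  -- the odd extension makes the operator symmetric.
  simp only [hc0, hp0] at hA hB
  have hd : Summable fun k : ℕ => (((k : ℝ) ^ 2 - 1) * Real.pi ^ 2 + 2 * κ) * (c k * p k) := by
    convert! (h2.mul_right (Real.pi ^ 2)).add (h0.mul_right (2 * κ - Real.pi ^ 2)) using 1
    funext k; ring
  have h1 : HasSum (fun k => c k * jacobi κ p k) _ :=
    (hd.hasSum.sub ((hf.hasSum.add hA).mul_left κ)).congr_fun fun k => by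
      simp only [jacobi, smul_eq_mul]; ring
  have h3 : HasSum (fun k => jacobi κ c k * p k) _ :=
    (hd.hasSum.sub ((hb.hasSum.add hB).mul_left κ)).congr_fun fun k => by
      simp only [jacobi, smul_eq_mul]; ring
  rw [h3.tsum_eq]
  convert! h1 using 1
  have : ∑' k, p (k + 2) * c k = ∑' k, c k * p (k + 2) := by simp only [mul_comm]
  rw [this]
  ring

/-! ### From the recurrence to the differential equation: solutions are unique up to a factor -/

theorem summable_inv_sq : Summable fun k : ℕ => 1 / ((k : ℝ) + 1) ^ 2 := by
  have := (summable_nat_add_iff 1).2 (Real.summable_one_div_nat_pow.2 (one_lt_two))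
  simpa using this

theorem summable_pow_mul {c : ℕ → ℝ} (h : ∃ C, ∀ k : ℕ, ((k : ℝ) + 1) ^ 5 * |c k| ≤ C) {n : ℕ}
    (hn : n ≤ 3) : Summable fun k : ℕ => (k : ℝ) ^ n * |c k| := by
  obtain ⟨C, hC⟩ := h
  refine Summable.of_nonneg_of_le (fun k => by positivity) (fun k => ?_)
    (summable_inv_sq.mul_left C)
  rw [mul_one_div, le_div_iff₀ (by positivity)]
  have hk : (0 : ℝ) ≤ k := k.cast_nonneg
  calc (k : ℝ) ^ n * |c k| * ((k : ℝ) + 1) ^ 2 ≤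
        ((k : ℝ) + 1) ^ n * |c k| * ((k : ℝ) + 1) ^ 2 := by gcongr; linarith
    _ ≤ ((k : ℝ) + 1) ^ 3 * |c k| * ((k : ℝ) + 1) ^ 2 := by gcongr; linarith
    _ = ((k : ℝ) + 1) ^ 5 * |c k| := by ring
    _ ≤ C := hC k

/-- Uniqueness for the initial value problem of a linear second order equation. -/
theorem eq_zero_of_second_order {u v q : ℝ → ℝ} {K : ℝ} (hu : ∀ x, HasDerivAt u (v x) x)
    (hv : ∀ x, HasDerivAt v (q x * u x) x) (hq : ∀ x, |q x| ≤ K) (hu0 : u 0 = 0) (hv0 : v 0 = 0) :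
    ∀ x ∈ Icc (0 : ℝ) 1, u x = 0 := by
  intro x hx
  have hd : ∀ x, HasDerivAt (fun x => (u x, v x)) (v x, q x * u x) x :=
    fun x => (hu x).prodMk (hv x)
  -- Grönwall for the pair `(u, u')` in the maximum norm; `K + 1` bounds both `|v| ≤ max` and `|q u|
  -- ≤ K max`.
  have := eq_zero_of_abs_deriv_le_mul_abs_self_of_eq_zero_right (f := fun x => (u x, v x))
    (f' := fun x => (v x, q x * u x)) (K := K + 1) (a := 0) (b := 1)
    (fun x _ => (hd x).continuousAt.continuousWithinAt) (fun x _ => (hd x).hasDerivWithinAt)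
    (by simp [hu0, hv0]) (fun x _ => ?_) x hx
  · exact congrArg Prod.fst this
  · have hK : 0 ≤ K := (abs_nonneg _).trans (hq x)
    simp only [Prod.norm_def, Real.norm_eq_abs, abs_mul]
    have hm1 := le_max_left |u x| |v x|
    have hm2 := le_max_right |u x| |v x|
    have hm := (abs_nonneg _).trans hm1
    refine max_le ?_ ?_
    · nlinarith
    · calc |q x| * |u x| ≤ K * max |u x| |v x| := by gcongr; exact hq x
        _ ≤ _ := by nlinarith

/-- A rapidly decaying solution of the recurrence is determined by the derivative at `0` of the
corresponding solution of the differential equation. -/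
theorem eq_zero_of_sum_eq_zero {κ : ℝ} {c : ℕ → ℝ} (hc0 : c 0 = 0) (hc : ∀ k, jacobi κ c k = 0)
    (h : ∃ C, ∀ k : ℕ, ((k : ℝ) + 1) ^ 5 * |c k| ≤ C) (hs : ∑' k : ℕ, (k : ℝ) * c k = 0) :
    ∀ k, c k = 0 := by
  have s0 : Summable fun k : ℕ => |c k| := by simpa using summable_pow_mul h (n := 0) (by omega)
  have s1 : Summable fun k : ℕ => (k : ℝ) * |c k| := by
    simpa using summable_pow_mul h (n := 1) (by omega)
  have s2 := summable_pow_mul h (n := 2) (by omega)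
  have r2 : (0 : ℝ) ≤ Real.sqrt 2 := Real.sqrt_nonneg 2
  have bd : ∀ (a t : ℝ), |t| ≤ Real.sqrt 2 → ‖a * t‖ ≤ Real.sqrt 2 * |a| := by
    intro a t ht
    rw [norm_mul, Real.norm_eq_abs, Real.norm_eq_abs, mul_comm]
    gcongr
  -- The solution of the differential equation and, below, its termwise derivative; the decay of `c`
  -- justifies two termwise differentiations.
  set u : ℝ → ℝ := fun x => ∑' k, c k * phi k x with hu
  set v : ℝ → ℝ := fun x => ∑' k : ℕ, c k *
    (Real.sqrt 2 * (k * Real.pi) * Real.cos (k * Real.pi * x)) with hv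
  have sphi : ∀ x, Summable fun k => c k * phi k x := fun x =>
    Summable.of_norm_bounded (s0.mul_left _) fun k => bd _ _ (abs_phi_le k x)
  have bd1 : ∀ (k : ℕ) (x : ℝ),
      ‖c k * (Real.sqrt 2 * (k * Real.pi) * Real.cos (k * Real.pi * x))‖ ≤
        Real.sqrt 2 * Real.pi * (k * |c k|) := by
    intro k x
    have h1 := Real.abs_cos_le_one (k * Real.pi * x)
    have hpi := Real.pi_pos.le
    rw [Real.norm_eq_abs, abs_mul, abs_mul, abs_of_nonneg (a := Real.sqrt 2 * (k * Real.pi))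
      (by positivity)]
    calc |c k| * (Real.sqrt 2 * (k * Real.pi) * |Real.cos (k * Real.pi * x)|) ≤
        |c k| * (Real.sqrt 2 * (k * Real.pi) * 1) := by gcongr
      _ = _ := by ring
  have bd2 : ∀ (k : ℕ) (x : ℝ), ‖c k * (-(k * Real.pi) ^ 2 * phi k x)‖ ≤
      Real.sqrt 2 * Real.pi ^ 2 * ((k : ℝ) ^ 2 * |c k|) := by
    intro k x
    rw [← mul_assoc]
    refine (bd _ _ (abs_phi_le k x)).trans (le_of_eq ?_)
    rw [abs_mul, abs_neg, abs_of_nonneg (a := (k * Real.pi) ^ 2) (by positivity)]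
    ring
  have hud : ∀ x, HasDerivAt u (v x) x := fun x =>
    hasDerivAt_tsum (s1.mul_left (Real.sqrt 2 * Real.pi))
      (fun k y => (hasDerivAt_phi k y).const_mul (c k)) bd1 (sphi 0) x
  have hvd : ∀ x, HasDerivAt v (∑' k : ℕ, c k * (-(k * Real.pi) ^ 2 * phi k x)) x := fun x =>
    hasDerivAt_tsum (s2.mul_left (Real.sqrt 2 * Real.pi ^ 2))
      (fun k y => (hasDerivAt_deriv_phi k y).const_mul (c k)) bd2
      (Summable.of_norm_bounded (s1.mul_left (Real.sqrt 2 * Real.pi)) fun k => bd1 k 0) x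
  have hode : ∀ x, ∑' k : ℕ, c k * (-(k * Real.pi) ^ 2 * phi k x) =
      (-Real.pi ^ 2 + 2 * κ * phi 1 x ^ 2) * u x := by
    intro x
    have sdd : Summable fun k : ℕ => c k * (-(k * Real.pi) ^ 2 * phi k x) :=
      Summable.of_norm_bounded (s2.mul_left (Real.sqrt 2 * Real.pi ^ 2)) fun k => bd2 k x
    -- Summation by parts moves the operator from the `φ_k` to `c`, where the recurrence makes it
    -- vanish; what remains is the differential equation.
    have hj := tsum_mul_jacobi (κ := κ) (c := c) (p := fun k => phi k x) hc0 (phi_zero x) (sphi x)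
      ?_ ?_ ?_
    · simp only [hc, zero_mul, tsum_zero] at hj
      have h2 : HasSum (fun k => c k * jacobi κ (fun k => phi k x) k) _ :=
        (sdd.hasSum.neg.add ((sphi x).hasSum.mul_left
          (-Real.pi ^ 2 + 2 * κ * phi 1 x ^ 2))).congr_fun ?_
      · have := h2.unique hj
        linarith
      · intro k
        rw [← operator_phi]; ring
    · refine (sdd.mul_left (-(Real.pi ^ 2)⁻¹)).congr fun k => ?_
      have := Real.pi_ne_zero
      field_simp
    · exact Summable.of_norm_bounded (s0.mul_left _) fun k => bd _ _ (abs_phi_le _ x)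
    · exact Summable.of_norm_bounded (((summable_nat_add_iff 2).2 s0).mul_left _)
        fun k => bd _ _ (abs_phi_le _ x)
  have hzero : ∀ x ∈ Icc (0 : ℝ) 1, u x = 0 := by
    refine eq_zero_of_second_order (q := fun x => -Real.pi ^ 2 + 2 * κ * phi 1 x ^ 2)
      (K := Real.pi ^ 2 + 2 * |κ| * 2) hud (fun x => by rw [← hode]; exact hvd x) (fun x => ?_) ?_ ?_
    · have hle : phi 1 x ^ 2 ≤ 2 := by
        have := pow_le_pow_left₀ (abs_nonneg _) (abs_phi_le 1 x) 2
        rwa [sq_abs, Real.sq_sqrt (by norm_num)] at this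
      refine (abs_add_le _ _).trans ?_
      rw [abs_neg, abs_of_nonneg (a := Real.pi ^ 2) (by positivity), abs_mul, abs_mul, abs_two,
        abs_of_nonneg (a := phi 1 x ^ 2) (by positivity)]
      gcongr
    · simp [hu, phi]
    · simp only [hv, mul_zero, Real.cos_zero, mul_one]
      rw [← mul_zero (Real.sqrt 2 * Real.pi), ← hs, ← tsum_mul_left]
      congr 1; funext k; ring
  intro j
  rcases eq_or_ne j 0 with rfl | hj
  · exact hc0
  have cphi : ∀ k, Continuous (phi k) := fun k => (contDiff_phi k).continuous
  have bdI : ∀ (k : ℕ) (x : ℝ), ‖c k * phi k x * phi j x‖ ≤ 2 * |c k| := by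
    intro k x
    have e1 := abs_phi_le k x
    have e2 := abs_phi_le j x
    rw [Real.norm_eq_abs, abs_mul, abs_mul, mul_assoc, mul_comm 2]
    gcongr
    calc _ ≤ Real.sqrt 2 * Real.sqrt 2 := by gcongr
      _ = 2 := Real.mul_self_sqrt (by norm_num)
  have hint : ∀ k, Integrable (fun x => c k * phi k x * phi j x) muI := fun k =>
    Integrable.of_bound ((continuous_const.mul (cphi k)).mul (cphi j)).aestronglyMeasurable (2 * |c k|)
      (Filter.Eventually.of_forall (bdI k))
  -- Integrating the vanishing series against `φ_j` recovers `c j` by orthonormality.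
  have hsum := hasSum_integral_of_summable_integral_norm hint ?_
  · have e1 : ∀ k, ∫ x, c k * phi k x * phi j x ∂muI = if k = j then c j else 0 := by
      intro k
      simp only [mul_assoc, integral_const_mul, integral_phi_mul_phi]
      by_cases hkj : k = j
      · subst hkj; simp [hj]
      · simp [hkj]
    have e2 : ∫ x, (∑' k, c k * phi k x * phi j x) ∂muI = 0 := by
      refine setIntegral_eq_zero_of_forall_eq_zero fun x hx => ?_
      rw [tsum_mul_right]
      have : (∑' k, c k * phi k x) = 0 := hzero x ⟨hx.1.le, hx.2.le⟩
      rw [this, zero_mul]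
    simp only [e1, e2] at hsum
    exact (hasSum_ite_eq j (c j)).unique hsum
  · refine Summable.of_nonneg_of_le (fun k => integral_nonneg fun x => norm_nonneg _) (fun k => ?_)
      (s0.mul_left 2)
    rw [integral_muI]
    have := intervalIntegral.norm_integral_le_of_norm_le_const (a := 0) (b := 1)
      (f := fun x => ‖c k * phi k x * phi j x‖) (C := 2 * |c k|)
      (fun x _ => by rw [norm_norm]; exact bdI k x)
    simpa using (le_abs_self _).trans this

/-- Solutions of the recurrence of at most cubic growth form a space of dimension at most one. -/
theorem solution_proportional {κ : ℝ} {c d : ℕ → ℝ}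
    (hc0 : c 0 = 0) (hc : ∀ k, jacobi κ c k = 0) (hcb : ∃ C, ∀ k : ℕ, |c k| ≤ C * ((k : ℝ) + 1) ^ 3)
    (hd0 : d 0 = 0) (hd : ∀ k, jacobi κ d k = 0) (hdb : ∃ C, ∀ k : ℕ, |d k| ≤ C * ((k : ℝ) + 1) ^ 3)
    (hne : ∃ k, c k ≠ 0) : ∃ t : ℝ, ∀ k, d k = t * c k := by
  have hc5 := rapid_decay hc hcb
  have hd5 := rapid_decay hd hdb
  have sc : Summable fun k : ℕ => (k : ℝ) * c k := by
    refine Summable.of_norm ((summable_pow_mul hc5 (n := 1) (by omega)).congr fun k => ?_)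
    simp
  have sd : Summable fun k : ℕ => (k : ℝ) * d k := by
    refine Summable.of_norm ((summable_pow_mul hd5 (n := 1) (by omega)).congr fun k => ?_)
    simp
  set a := ∑' k : ℕ, (k : ℝ) * c k with ha
  set b := ∑' k : ℕ, (k : ℝ) * d k with hb
  have ha0 : a ≠ 0 := by
    intro h
    obtain ⟨k, hk⟩ := hne
    exact hk (eq_zero_of_sum_eq_zero hc0 hc hc5 h k)
  -- Up to the factor `√2 π`, `a` and `b` are the derivatives at `0` of the two solutions, so `d -
  -- (b / a) c` has derivative `0` there.
  refine ⟨b / a, fun k => ?_⟩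
  have key : ∀ k, d k - b / a * c k = 0 := by
    refine eq_zero_of_sum_eq_zero (κ := κ) (by simp [hc0, hd0]) (fun k => ?_) ?_ ?_
    · have e : jacobi κ (fun k => d k - b / a * c k) k =
          jacobi κ d k - b / a * jacobi κ c k := by
        match k with
        | 0 => simp only [jacobi, shiftBack, smul_eq_mul]; ring
        | 1 => simp only [jacobi, shiftBack, smul_eq_mul]; ring
        | k + 2 => simp only [jacobi, shiftBack, smul_eq_mul]; ring
      rw [e, hc, hd]; simp
    · obtain ⟨C, hC⟩ := hc5
      obtain ⟨D, hD⟩ := hd5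
      refine ⟨D + |b / a| * C, fun k => ?_⟩
      calc ((k : ℝ) + 1) ^ 5 * |d k - b / a * c k| ≤
            ((k : ℝ) + 1) ^ 5 * (|d k| + |b / a| * |c k|) := by
              gcongr; rw [← abs_mul]; exact abs_sub _ _
        _ = ((k : ℝ) + 1) ^ 5 * |d k| + |b / a| * (((k : ℝ) + 1) ^ 5 * |c k|) := by ring
        _ ≤ _ := by gcongr <;> [exact hD k; exact hC k]
    · have := (sd.hasSum.sub (sc.hasSum.mul_left (b / a))).tsum_eq
      rw [← ha, ← hb, div_mul_cancel₀ _ ha0, sub_self] at this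
      rw [← this]
      congr 1; funext k; ring
  linarith [key k]

/-! ### Completeness of the sine system -/

section Completeness

variable {f : ℝ → ℝ}

theorem integrable_mul_of_continuous (hf : Integrable f muI) {g : ℝ → ℝ} (hg : Continuous g) :
    Integrable (fun x => f x * g x) muI := by
  obtain ⟨C, hC⟩ := (isCompact_Icc (a := (0 : ℝ)) (b := 1)).exists_bound_of_continuousOn
    hg.continuousOn
  refine hf.mul_bdd (c := C) hg.aestronglyMeasurable ?_
  filter_upwards [ae_restrict_mem (μ := volume) (s := Ioo (0 : ℝ) 1) measurableSet_Ioo] with x hx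
  exact hC x ⟨hx.1.le, hx.2.le⟩

/-- Induction on `n`, for all `k` at once, by `2 cos(πx) φ_{k+1} = φ_{k+2} + φ_k`. -/
theorem integral_mul_sin_mul_cos_pow (hf : Integrable f muI)
    (h : ∀ k : ℕ, ∫ x, f x * phi k x ∂muI = 0) (n : ℕ) :
    ∀ k : ℕ, ∫ x, f x * (phi k x * Real.cos (Real.pi * x) ^ n) ∂muI = 0 := by
  induction n with
  | zero => simpa using h
  | succ n ih =>
    intro k
    match k with
    | 0 => simp [phi_zero]
    | k + 1 =>
      have e : ∀ x, f x * (phi (k + 1) x * Real.cos (Real.pi * x) ^ (n + 1)) =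
          (1 / 2) * (f x * (phi (k + 2) x * Real.cos (Real.pi * x) ^ n)) +
          (1 / 2) * (f x * (phi k x * Real.cos (Real.pi * x) ^ n)) := by
        intro x
        have h1 : phi (k + 2) x = Real.sqrt 2 * Real.sin ((k + 1) * Real.pi * x + Real.pi * x) := by
          simp only [phi, Nat.cast_add, Nat.cast_ofNat]; congr 2; ring
        have h2 : phi k x = Real.sqrt 2 * Real.sin ((k + 1) * Real.pi * x - Real.pi * x) := by
          simp only [phi]; congr 2; ring
        have h3 : phi (k + 1) x = Real.sqrt 2 * Real.sin ((k + 1) * Real.pi * x) := by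
          simp only [phi, Nat.cast_add, Nat.cast_one]
        rw [h1, h2, h3, Real.sin_add, Real.sin_sub]
        ring
      simp only [e]
      have hint : ∀ j, Integrable (fun x => f x * (phi j x * Real.cos (Real.pi * x) ^ n)) muI :=
        fun j => integrable_mul_of_continuous hf
          ((contDiff_phi j).continuous.mul (by fun_prop))
      rw [integral_add ((hint _).const_mul _) ((hint _).const_mul _), integral_const_mul,
        integral_const_mul, ih, ih]
      simp

/-- Completeness of the system `φ_1, φ_2, …`. -/
theorem ae_eq_zero_of_integral_mul_phi (hf : Integrable f muI)
    (h : ∀ k : ℕ, ∫ x, f x * phi k x ∂muI = 0) : f =ᵐ[muI] 0 := by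
  -- The weight `φ_1` makes `g` orthogonal to all polynomials in `cos πx`; it has no zero in `I`, so
  -- `g = 0` gives `f = 0`.
  set g : ℝ → ℝ := fun x => f x * phi 1 x with hg
  have cphi : Continuous (phi 1) := (contDiff_phi 1).continuous
  have hgi : Integrable g muI := integrable_mul_of_continuous hf cphi
  have hpoly : ∀ p : Polynomial ℝ, ∫ x, g x * p.eval (Real.cos (Real.pi * x)) ∂muI = 0 := by
    intro p
    induction p using Polynomial.induction_on' with
    | add p q hp hq =>
      simp only [Polynomial.eval_add, mul_add]
      rw [integral_add, hp, hq, add_zero] <;>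
      exact integrable_mul_of_continuous hgi (by fun_prop)
    | monomial n a =>
      simp only [Polynomial.eval_monomial]
      have : ∀ x, g x * (a * Real.cos (Real.pi * x) ^ n) =
          a * (f x * (phi 1 x * Real.cos (Real.pi * x) ^ n)) := fun x => by simp only [hg]; ring
      simp only [this, integral_const_mul, integral_mul_sin_mul_cos_pow hf h n 1, mul_zero]
  have hcont : ∀ η : ℝ → ℝ, Continuous η → ∫ x, g x * η x ∂muI = 0 := by
    intro η hη
    set B := ∫ x, |g x| ∂muI with hB
    have hB0 : 0 ≤ B := integral_nonneg fun x => abs_nonneg _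
    refine abs_eq_zero.1 (le_antisymm (le_of_forall_pos_le_add fun ε hε => ?_) (abs_nonneg _))
    -- Weierstrass in the variable `y = cos πx`, a homeomorphism of `[0, 1]` onto `[-1, 1]`. The
    -- tolerance is divided by the `L¹` norm of `g`, plus `1` to avoid zero.
    obtain ⟨p, hp⟩ := exists_polynomial_near_of_continuousOn (-1) 1
      (fun y => η (Real.arccos y / Real.pi))
      ((hη.comp (Real.continuous_arccos.div_const _)).continuousOn) (ε / (B + 1)) (by positivity)
    have hcp : Continuous fun x => p.eval (Real.cos (Real.pi * x)) := by fun_prop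
    have e : ∫ x, g x * η x ∂muI =
        ∫ x, g x * (η x - p.eval (Real.cos (Real.pi * x))) ∂muI := by
      simp only [mul_sub]
      rw [integral_sub (integrable_mul_of_continuous hgi hη)
        (integrable_mul_of_continuous hgi hcp), hpoly, sub_zero]
    rw [e, zero_add, ← Real.norm_eq_abs]
    refine (norm_integral_le_of_norm_le (g := fun x => |g x| * (ε / (B + 1)))
      (hgi.abs.mul_const _) ?_).trans ?_
    · filter_upwards [ae_restrict_mem (μ := volume) (s := Ioo (0 : ℝ) 1) measurableSet_Ioo] with x hx
      rw [norm_mul, Real.norm_eq_abs, Real.norm_eq_abs]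
      have := hp (Real.cos (Real.pi * x)) ⟨Real.neg_one_le_cos _, Real.cos_le_one _⟩
      rw [Real.arccos_cos (by nlinarith [Real.pi_pos, hx.1]) (by nlinarith [Real.pi_pos, hx.2]),
        mul_div_cancel_left₀ _ Real.pi_ne_zero, abs_sub_comm] at this
      gcongr
    · rw [integral_mul_const, ← hB, mul_div_assoc', div_le_iff₀ (by positivity)]
      nlinarith
  have hz := isOpen_Ioo.ae_eq_zero_of_integral_contDiff_smul_eq_zero (μ := volume) (f := g)
    (U := Ioo (0 : ℝ) 1) (IntegrableOn.locallyIntegrableOn hgi) (fun η hη _ hs => by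
      rw [← hcont η hη.continuous, muI, ← setIntegral_eq_integral_of_forall_compl_eq_zero
        (s := Ioo (0 : ℝ) 1)]
      · simp only [smul_eq_mul, mul_comm]
      · intro x hx
        rw [image_eq_zero_of_notMem_tsupport fun hx' => hx (hs hx'), zero_smul])
  rw [Filter.EventuallyEq, muI, ae_restrict_iff' measurableSet_Ioo]
  filter_upwards [hz] with x hx hxI
  have h1 : phi 1 x ≠ 0 := by
    have : 0 < Real.sin (Real.pi * x) :=
      Real.sin_pos_of_pos_of_lt_pi (by nlinarith [Real.pi_pos, hxI.1])
        (by nlinarith [Real.pi_pos, hxI.2])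
    simp [phi, this.ne']
  simpa [hg, h1] using hx hxI

end Completeness

/-! ### Testing weak derivatives against sines by cutoff -/

/-- A smooth cutoff, equal to `1` on `[2/n, 1 - 2/n]` and supported in `[1/n, 1 - 1/n]`. -/
noncomputable def cutoff (n : ℕ) (x : ℝ) : ℝ :=
  Real.smoothTransition (n * x - 1) * Real.smoothTransition (n * (1 - x) - 1)

theorem contDiff_smoothTransition_infty : ContDiff ℝ ∞ Real.smoothTransition :=
  Real.smoothTransition.contDiff

theorem contDiff_cutoff (n : ℕ) : ContDiff ℝ ∞ (cutoff n) := by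
  unfold cutoff
  exact (contDiff_smoothTransition_infty.comp (by fun_prop)).mul
    (contDiff_smoothTransition_infty.comp (by fun_prop))

theorem isTest_cutoff_mul {n : ℕ} (hn : 0 < n) {p : ℝ → ℝ} (hp : ContDiff ℝ ∞ p) :
    IsTest (fun x => cutoff n x * p x) := by
  have hn' : (0 : ℝ) < n := by exact_mod_cast hn
  have hsub : tsupport (fun x => cutoff n x * p x) ⊆ Icc (1 / (n : ℝ)) (1 - 1 / n) := by
    refine closure_minimal (fun x hx => ?_) isClosed_Icc
    by_contra hx'
    refine hx ?_
    have : n * x - 1 ≤ 0 ∨ n * (1 - x) - 1 ≤ 0 := by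
      by_contra! h
      refine hx' ⟨?_, ?_⟩
      · rw [div_le_iff₀ hn']; linarith [h.1]
      · rw [le_sub_comm, div_le_iff₀ hn']; linarith [h.2]
    rcases this with h | h <;> simp [cutoff, Real.smoothTransition.zero_of_nonpos h]
  have hpos : 0 < 1 / (n : ℝ) := by positivity
  exact ⟨(contDiff_cutoff n).mul hp,
    HasCompactSupport.of_support_subset_isCompact isCompact_Icc (subset_closure.trans hsub),
    hsub.trans fun x hx => ⟨by linarith [hx.1], by linarith [hx.2]⟩⟩

theorem deriv_smoothTransition_eq_zero {t : ℝ} (ht : 1 < t) : deriv Real.smoothTransition t = 0 := by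
  have : Real.smoothTransition =ᶠ[nhds t] fun _ => 1 := by
    filter_upwards [Ioi_mem_nhds ht] with s hs
    exact Real.smoothTransition.one_of_one_le (le_of_lt hs)
  rw [this.deriv_eq, deriv_const]

theorem deriv_smoothTransition_eq_zero' {t : ℝ} (ht : t < 0) :
    deriv Real.smoothTransition t = 0 := by
  have : Real.smoothTransition =ᶠ[nhds t] fun _ => 0 := by
    filter_upwards [Iio_mem_nhds ht] with s hs
    exact Real.smoothTransition.zero_of_nonpos (le_of_lt hs)
  rw [this.deriv_eq, deriv_const]

theorem exists_bound_deriv_smoothTransition :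
    ∃ M, 0 ≤ M ∧ ∀ t, |deriv Real.smoothTransition t| ≤ M := by
  obtain ⟨C, hC⟩ := (isCompact_Icc (a := (0 : ℝ)) (b := 1)).exists_bound_of_continuousOn
    (contDiff_smoothTransition_infty.continuous_deriv (by simp)).continuousOn
  have hC0 : 0 ≤ C := (norm_nonneg _).trans (hC 0 (by simp))
  refine ⟨C, hC0, fun t => ?_⟩
  rcases lt_or_ge t 0 with h | h
  · simpa [deriv_smoothTransition_eq_zero' h]
  rcases lt_or_ge 1 t with h1 | h1
  · simpa [deriv_smoothTransition_eq_zero h1]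
  exact hC t ⟨h, h1⟩

theorem hasDerivAt_cutoff (n : ℕ) (x : ℝ) : HasDerivAt (cutoff n)
    (deriv Real.smoothTransition (n * x - 1) * n * Real.smoothTransition (n * (1 - x) - 1) -
      Real.smoothTransition (n * x - 1) * (deriv Real.smoothTransition (n * (1 - x) - 1) * n)) x := by
  have hT : ∀ t, HasDerivAt Real.smoothTransition (deriv Real.smoothTransition t) t := fun t =>
    ((contDiff_smoothTransition_infty.differentiable (by simp)) t).hasDerivAt
  have h1 : HasDerivAt (fun x : ℝ => n * x - 1) n x := by
    simpa using ((hasDerivAt_id x).const_mul (n : ℝ)).sub_const 1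
  have h2 : HasDerivAt (fun x : ℝ => n * (1 - x) - 1) (-n) x := by
    simpa using (((hasDerivAt_id x).const_sub 1).const_mul (n : ℝ)).sub_const 1
  convert! ((hT _).comp x h1).mul ((hT _).comp x h2) using 1
  simp only [Function.comp]; ring

theorem abs_cutoff_le (n : ℕ) (x : ℝ) : |cutoff n x| ≤ 1 := by
  have h1 := Real.smoothTransition.nonneg (n * x - 1)
  have h2 := Real.smoothTransition.nonneg (n * (1 - x) - 1)
  rw [cutoff, abs_of_nonneg (mul_nonneg h1 h2)]
  exact mul_le_one₀ (Real.smoothTransition.le_one _) h2 (Real.smoothTransition.le_one _)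

/-- Both arguments of the transition function exceed `1` once `n x > 2` and `n (1 - x) > 2`. This
gives the pointwise limits for dominated convergence. -/
theorem cutoff_eventually {x : ℝ} (hx : x ∈ Ioo (0 : ℝ) 1) :
    ∀ᶠ n : ℕ in Filter.atTop, cutoff n x = 1 ∧ deriv (cutoff n) x = 0 := by
  have h1 := (tendsto_natCast_atTop_atTop (R := ℝ)).atTop_mul_const hx.1
  have h2 := (tendsto_natCast_atTop_atTop (R := ℝ)).atTop_mul_const (sub_pos.2 hx.2)
  filter_upwards [h1.eventually_gt_atTop 2, h2.eventually_gt_atTop 2] with n hn1 hn2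
  have e1 : 1 < n * x - 1 := by linarith
  have e2 : 1 < n * (1 - x) - 1 := by linarith
  rw [(hasDerivAt_cutoff n x).deriv, deriv_smoothTransition_eq_zero e1,
    deriv_smoothTransition_eq_zero e2, cutoff, Real.smoothTransition.one_of_one_le e1.le,
    Real.smoothTransition.one_of_one_le e2.le]
  simp

/-- If `p` vanishes at the end points with linear rate, the functions `cutoff n' * p` are bounded
uniformly in `n`. -/
theorem exists_bound_deriv_cutoff_mul {p : ℝ → ℝ} {A : ℝ} (hA : 0 ≤ A)
    (h0 : ∀ x, |p x| ≤ A * |x|) (h1 : ∀ x, |p x| ≤ A * |1 - x|) :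
    ∃ B, ∀ n : ℕ, ∀ x ∈ Ioo (0 : ℝ) 1, |deriv (cutoff n) x * p x| ≤ B := by
  obtain ⟨M, hM0, hM⟩ := exists_bound_deriv_smoothTransition
  -- The derivative of the transition vanishes for `n y > 2`; elsewhere linear vanishing absorbs the
  -- factor `n`, as `n |z| ≤ A n y ≤ 2A`.
  have key : ∀ (n : ℕ) (y z : ℝ), 0 < y → |z| ≤ A * |y| →
      |deriv Real.smoothTransition (n * y - 1) * n * z| ≤ 2 * M * A := by
    intro n y z hy hz
    rcases lt_or_ge 2 (n * y) with h | h
    · rw [deriv_smoothTransition_eq_zero (by linarith)]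
      simp; positivity
    · rw [abs_mul, abs_mul, Nat.abs_cast]
      rw [abs_of_pos hy] at hz
      calc |deriv Real.smoothTransition (n * y - 1)| * n * |z| ≤ M * n * (A * y) := by
            gcongr; exact hM _
        _ = M * A * (n * y) := by ring
        _ ≤ M * A * 2 := by gcongr
        _ = _ := by ring
  have hT : ∀ t, |Real.smoothTransition t| ≤ 1 := fun t => by
    rw [abs_of_nonneg (Real.smoothTransition.nonneg t)]; exact Real.smoothTransition.le_one t
  refine ⟨4 * M * A, fun n x hx => ?_⟩
  have k1 := key n x (p x) hx.1 (h0 x)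
  have k2 := key n (1 - x) (p x) (sub_pos.2 hx.2) (h1 x)
  rw [(hasDerivAt_cutoff n x).deriv]
  rw [show ∀ a b c d e : ℝ, (a * e * b - c * (d * e)) * p x = (a * e * p x) * b - (d * e * p x) * c
    from fun a b c d e => by ring]
  refine (abs_sub _ _).trans ?_
  rw [abs_mul, abs_mul (_ * _ * p x)]
  have b1 := mul_le_mul k1 (hT (n * (1 - x) - 1)) (abs_nonneg _) (by positivity)
  have b2 := mul_le_mul k2 (hT (n * x - 1)) (abs_nonneg _) (by positivity)
  linarith

theorem abs_phi_le_left (k : ℕ) (x : ℝ) : |phi k x| ≤ Real.sqrt 2 * (k * Real.pi) * |x| := by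
  have hpi := Real.pi_pos
  rw [phi, abs_mul, abs_of_nonneg (Real.sqrt_nonneg 2), mul_assoc (Real.sqrt 2)]
  gcongr
  refine (Real.abs_sin_le_abs).trans (le_of_eq ?_)
  rw [abs_mul, abs_of_nonneg (a := k * Real.pi) (by positivity)]

theorem abs_phi_le_right (k : ℕ) (x : ℝ) : |phi k x| ≤ Real.sqrt 2 * (k * Real.pi) * |1 - x| := by
  have h : |phi k (1 - x)| = |phi k x| := by
    have hc : |Real.cos (k * Real.pi)| = 1 := by simp [Real.cos_nat_mul_pi]
    rw [phi, phi, show k * Real.pi * (1 - x) = k * Real.pi - k * Real.pi * x by ring, Real.sin_sub,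
      Real.sin_nat_mul_pi, zero_mul, zero_sub, abs_mul, abs_neg, abs_mul, hc, one_mul, ← abs_mul]
  rw [← h]
  exact abs_phi_le_left k (1 - x)

/-- Weak derivatives may be tested against the sine functions. -/
theorem HasWeakDeriv.integral_phi {f g : ℝ → ℝ} (h : HasWeakDeriv f g) (hf : Integrable f muI)
    (hg : Integrable g muI) (k : ℕ) :
    ∫ x, f x * deriv (phi k) x ∂muI = -∫ x, g x * phi k x ∂muI := by
  obtain ⟨B, hB⟩ := exists_bound_deriv_cutoff_mul (p := phi k)
    (A := Real.sqrt 2 * (k * Real.pi)) (by have := Real.pi_pos; positivity)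
    (abs_phi_le_left k) (abs_phi_le_right k)
  have hd : ∀ x, deriv (phi k) x = Real.sqrt 2 * (k * Real.pi) * Real.cos (k * Real.pi * x) :=
    fun x => (hasDerivAt_phi k x).deriv
  have hdb : ∀ x, |deriv (phi k) x| ≤ Real.sqrt 2 * (k * Real.pi) := fun x => by
    have hpi := Real.pi_pos
    rw [hd, abs_mul, abs_of_nonneg (a := Real.sqrt 2 * (k * Real.pi)) (by positivity)]
    exact mul_le_of_le_one_right (by positivity) (Real.abs_cos_le_one _)
  have hmem := ae_restrict_mem (μ := volume) (s := Ioo (0 : ℝ) 1) measurableSet_Ioo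
  have htest : ∀ n : ℕ, 0 < n → IsTest (fun x => cutoff n x * phi k x) := fun n hn =>
    isTest_cutoff_mul hn (contDiff_phi k)
  have hder : ∀ n x, deriv (fun x => cutoff n x * phi k x) x =
      deriv (cutoff n) x * phi k x + cutoff n x * deriv (phi k) x := fun n x =>
    deriv_fun_mul ((contDiff_cutoff n).differentiable (by simp) x)
      ((contDiff_phi k).differentiable (by simp) x)
  have hcd : ∀ n, Continuous (deriv fun x => cutoff n x * phi k x) := fun n =>
    ((contDiff_cutoff n).mul (contDiff_phi k)).continuous_deriv (by simp)
  -- No boundary condition on `f` is needed: `B` dominates `cutoff n' * φ_k` because `φ_k` itself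
  -- vanishes at the end points.
  have l1 : Filter.Tendsto (fun n : ℕ => ∫ x, f x * deriv (fun x => cutoff n x * phi k x) x ∂muI)
      Filter.atTop (nhds (∫ x, f x * deriv (phi k) x ∂muI)) := by
    refine tendsto_integral_of_dominated_convergence
      (fun x => |f x| * (B + Real.sqrt 2 * (k * Real.pi)))
      (fun n => hf.aestronglyMeasurable.mul (hcd n).aestronglyMeasurable)
      (hf.abs.mul_const _) (fun n => ?_) ?_
    · filter_upwards [hmem] with x hx
      rw [norm_mul, Real.norm_eq_abs, Real.norm_eq_abs, hder]
      gcongr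
      refine (abs_add_le _ _).trans (add_le_add (hB n x hx) ?_)
      rw [abs_mul]
      exact (mul_le_of_le_one_left (abs_nonneg _) (abs_cutoff_le n x)).trans (hdb x)
    · filter_upwards [hmem] with x hx
      refine tendsto_const_nhds.congr' ?_
      filter_upwards [cutoff_eventually hx] with n hn
      rw [hder, hn.1, hn.2]; ring
  have l2 : Filter.Tendsto (fun n : ℕ => ∫ x, g x * (cutoff n x * phi k x) ∂muI)
      Filter.atTop (nhds (∫ x, g x * phi k x ∂muI)) := by
    refine tendsto_integral_of_dominated_convergence (fun x => |g x| * Real.sqrt 2)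
      (fun n => hg.aestronglyMeasurable.mul
        ((contDiff_cutoff n).mul (contDiff_phi k)).continuous.aestronglyMeasurable)
      (hg.abs.mul_const _) (fun n => ?_) ?_
    · refine Filter.Eventually.of_forall fun x => ?_
      rw [norm_mul, Real.norm_eq_abs, Real.norm_eq_abs, abs_mul]
      gcongr
      exact (mul_le_of_le_one_left (abs_nonneg _) (abs_cutoff_le n x)).trans (abs_phi_le k x)
    · filter_upwards [hmem] with x hx
      refine tendsto_const_nhds.congr' ?_
      filter_upwards [cutoff_eventually hx] with n hn
      rw [hn.1, one_mul]
  refine tendsto_nhds_unique l1 (l2.neg.congr' ?_)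
  filter_upwards [Filter.eventually_gt_atTop 0] with n hn
  exact (h _ (htest n hn)).symm

/-- The interval has measure `1`, so the `L¹` norm is at most the `L²` norm. -/
theorem abs_integral_mul_le {f b : ℝ → ℝ} {B : ℝ} {ε : ℝ} (hB0 : 0 ≤ B) (hε : 0 ≤ ε)
    (hf : MemLp f 2 muI) (hfε : eLpNorm f 2 muI ≤ ENNReal.ofReal ε) (hB : ∀ x, |b x| ≤ B) :
    |∫ x, f x * b x ∂muI| ≤ ε * B := by
  have hprob : muI univ = 1 := by simp [muI]
  have h1 : ∫ x, |f x| ∂muI ≤ ε := by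
    have hle : eLpNorm f 1 muI ≤ eLpNorm f 2 muI := by
      have : IsProbabilityMeasure muI := ⟨hprob⟩
      exact eLpNorm_le_eLpNorm_of_exponent_le (by norm_num) hf.1
    have hi : ∫ x, ‖f x‖ ∂muI = (eLpNorm f 1 muI).toReal := by
      rw [integral_norm_eq_lintegral_enorm hf.1, eLpNorm_one_eq_lintegral_enorm]
    simp only [Real.norm_eq_abs] at hi
    rw [hi]
    exact ENNReal.toReal_le_of_le_ofReal hε (hle.trans hfε)
  rw [← Real.norm_eq_abs]
  refine (norm_integral_le_of_norm_le (g := fun x => |f x| * B)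
    ((hf.integrable (by norm_num)).abs.mul_const B) (Filter.Eventually.of_forall fun x => ?_)).trans ?_
  · rw [norm_mul, Real.norm_eq_abs, Real.norm_eq_abs]
    gcongr
    exact hB x
  · rw [integral_mul_const]
    gcongr

theorem integral_deriv_mul_deriv_phi {η : ℝ → ℝ} (hη : IsTest η) (k : ℕ) :
    ∫ x, deriv η x * deriv (phi k) x ∂muI = (k * Real.pi) ^ 2 * ∫ x, η x * phi k x ∂muI := by
  have h0 : η 0 = 0 := image_eq_zero_of_notMem_tsupport fun h => by simpa using hη.2.2 h
  have h1 : η 1 = 0 := image_eq_zero_of_notMem_tsupport fun h => by simpa using hη.2.2 h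
  have hd : deriv (phi k) =
      fun x => Real.sqrt 2 * (k * Real.pi) * Real.cos (k * Real.pi * x) :=
    funext fun x => (hasDerivAt_phi k x).deriv
  rw [integral_muI, integral_muI, hd]
  have := intervalIntegral.integral_mul_deriv_eq_deriv_mul (a := 0) (b := 1)
    (u := fun x => Real.sqrt 2 * (k * Real.pi) * Real.cos (k * Real.pi * x)) (v := η)
    (fun x _ => hasDerivAt_deriv_phi k x)
    (fun x _ => (hη.1.differentiable (by simp) x).hasDerivAt)
    ((continuous_const.mul (contDiff_phi k).continuous).intervalIntegrable _ _)
    ((hη.1.continuous_deriv (by simp)).intervalIntegrable _ _)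
  simp only [h0, h1, mul_zero, sub_zero, zero_sub] at this
  simp only [mul_comm (deriv η _)]
  rw [this, ← intervalIntegral.integral_neg, ← intervalIntegral.integral_const_mul]
  congr 1; funext x; ring

/-- The boundary condition: integration by parts against `φ_k'` has no boundary terms. -/
theorem InDomain.integral_deriv_phi {u u1 u2 : ℝ → ℝ} (h : InDomain u u1 u2) (k : ℕ) :
    ∫ x, u1 x * deriv (phi k) x ∂muI = (k * Real.pi) ^ 2 * ∫ x, u x * phi k x ∂muI := by
  have hpi := Real.pi_pos
  set A : ℝ := Real.sqrt 2 * (k * Real.pi) with hA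
  have hA0 : 0 ≤ A := by positivity
  have hdb : ∀ x, |deriv (phi k) x| ≤ A := fun x => by
    rw [(hasDerivAt_phi k x).deriv, abs_mul, abs_of_nonneg (a := Real.sqrt 2 * (k * Real.pi)) hA0]
    exact mul_le_of_le_one_right hA0 (Real.abs_cos_le_one _)
  have cphi : Continuous (phi k) := (contDiff_phi k).continuous
  have cdphi : Continuous (deriv (phi k)) := (contDiff_phi k).continuous_deriv (by simp)
  set D : ℝ := A + (k * Real.pi) ^ 2 * Real.sqrt 2 with hD
  have hD0 : 0 ≤ D := by positivity
  rw [← sub_eq_zero, ← abs_eq_zero]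
  refine le_antisymm (le_of_forall_pos_le_add fun ε hε => ?_) (abs_nonneg _)
  have hδ : 0 < ε / (D + 1) := by positivity
  -- Replacing `u` and `u1` by `η` and `η'` with errors below `δ` changes the two sides by at most
  -- `δ D` in total; `D + 1` keeps the quotient defined.
  obtain ⟨η, hη, e0, e1⟩ := h.dirichlet (ENNReal.ofReal (ε / (D + 1))) (ENNReal.ofReal_pos.2 hδ)
  have cη : Continuous η := hη.1.continuous
  have cdη : Continuous (deriv η) := hη.1.continuous_deriv (by simp)
  have mη : MemLp η 2 muI := (cη.memLp_of_hasCompactSupport hη.2.1).restrict _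
  have mdη : MemLp (deriv η) 2 muI := (cdη.memLp_of_hasCompactSupport hη.2.1.deriv).restrict _
  have i1 := abs_integral_mul_le hA0 hδ.le (h.memLp_one.sub mdη) e1.le hdb
  have i0 := abs_integral_mul_le (Real.sqrt_nonneg 2) hδ.le (h.memLp.sub mη) e0.le (abs_phi_le k)
  have int : ∀ {f b : ℝ → ℝ}, MemLp f 2 muI → Continuous b → Integrable (fun x => f x * b x) muI :=
    fun hf hb => integrable_mul_of_continuous (hf.integrable (by norm_num)) hb
  simp only [Pi.sub_apply, sub_mul] at i1 i0
  rw [integral_sub (int h.memLp_one cdphi) (int mdη cdphi), integral_deriv_mul_deriv_phi hη] at i1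
  rw [integral_sub (int h.memLp cphi) (int mη cphi)] at i0
  set a := ∫ x, u1 x * deriv (phi k) x ∂muI
  set b := ∫ x, u x * phi k x ∂muI
  set c := ∫ x, η x * phi k x ∂muI
  calc |a - (k * Real.pi) ^ 2 * b| =
        |(a - (k * Real.pi) ^ 2 * c) - (k * Real.pi) ^ 2 * (b - c)| := by congr 1; ring
    _ ≤ |a - (k * Real.pi) ^ 2 * c| + |(k * Real.pi) ^ 2 * (b - c)| := abs_sub _ _
    _ ≤ ε / (D + 1) * A + (k * Real.pi) ^ 2 * (ε / (D + 1) * Real.sqrt 2) := by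
        rw [abs_mul, abs_of_nonneg (a := (k * Real.pi) ^ 2) (by positivity)]
        gcongr
    _ = ε * D / (D + 1) := by rw [hD]; ring
    _ ≤ 0 + ε := by rw [div_le_iff₀ (by positivity)]; nlinarith

/-! ### Eigenfunctions for the eigenvalue zero solve the recurrence -/

theorem integral_mul_shiftBack {u : ℝ → ℝ} (k : ℕ) :
    ∫ x, u x * shiftBack (fun j => phi j x) k ∂muI =
      shiftBack (fun j => ∫ x, u x * phi j x ∂muI) k := by
  match k with
  | 0 => simp only [shiftBack, mul_neg, integral_neg]
  | 1 => simp only [shiftBack, mul_neg, integral_neg]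
  | k + 2 => simp only [shiftBack]

theorem integral_mul_jacobi {u : ℝ → ℝ} (hu : Integrable u muI) (κ : ℝ) (k : ℕ) :
    ∫ x, u x * jacobi κ (fun j => phi j x) k ∂muI =
      jacobi κ (fun j => ∫ x, u x * phi j x ∂muI) k := by
  have cphi : ∀ k, Continuous (phi k) := fun k => (contDiff_phi k).continuous
  have int : ∀ k, Integrable (fun x => u x * phi k x) muI := fun k =>
    integrable_mul_of_continuous hu (cphi k)
  have intb : Integrable (fun x => u x * shiftBack (fun j => phi j x) k) muI := by
    refine integrable_mul_of_continuous hu ?_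
    match k with
    | 0 => exact (cphi 2).neg
    | 1 => exact (cphi 1).neg
    | k + 2 => exact cphi k
  simp only [jacobi, smul_eq_mul, mul_sub, mul_add, mul_left_comm (u _)]
  rw [integral_sub, integral_const_mul, integral_add, integral_const_mul, integral_const_mul,
    integral_mul_shiftBack]
  · exact (int _).const_mul _
  · exact intb.const_mul _
  · exact (int _).const_mul _
  · exact ((int _).const_mul _).add (intb.const_mul _)

/-- The sine coefficients of an eigenfunction for the eigenvalue `0` solve the recurrence. -/
theorem IsEigenfunction.jacobi_eq_zero {κ : ℝ} {u : ℝ → ℝ} (h : IsEigenfunction κ 0 u) (k : ℕ) :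
    jacobi κ (fun j => ∫ x, u x * phi j x ∂muI) k = 0 := by
  obtain ⟨-, u1, u2, hd, heq⟩ := h
  have iu : Integrable u muI := hd.memLp.integrable (by norm_num)
  have iu1 : Integrable u1 muI := hd.memLp_one.integrable (by norm_num)
  have iu2 : Integrable u2 muI := hd.memLp_two.integrable (by norm_num)
  have cphi : ∀ k, Continuous (phi k) := fun k => (contDiff_phi k).continuous
  have h2 := hd.weak_two.integral_phi iu1 iu2 k
  -- Two integrations by parts: `weak_two` moves the derivative off `u2`, and the Dirichlet
  -- condition moves it off `u1`.
  rw [hd.integral_deriv_phi k] at h2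
  rw [← integral_mul_jacobi iu]
  have e : ∀ᵐ x ∂muI, u x * jacobi κ (fun j => phi j x) k =
      (k * Real.pi) ^ 2 * (u x * phi k x) + u2 x * phi k x := by
    filter_upwards [heq] with x hx
    rw [← operator_phi]
    linear_combination phi k x * hx
  rw [integral_congr_ae e, integral_add, integral_const_mul, h2]
  · simp
  · exact (integrable_mul_of_continuous iu (cphi k)).const_mul _
  · exact integrable_mul_of_continuous iu2 (cphi k)

/-! ### The space `Hinf κ` as a span of sines -/

section

/-- `φ_k` as a complex-valued function. -/
noncomputable def phiC (k : ℕ) (x : ℝ) : ℂ := (phi k x : ℂ)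

/-- The smooth functions, as a real vector space. -/
def smoothSubmodule : Submodule ℝ (ℝ → ℂ) where
  carrier := {f | ContDiff ℝ ∞ f}
  zero_mem' := show ContDiff ℝ ∞ fun _ : ℝ => (0 : ℂ) from contDiff_const
  add_mem' {f g} hf hg := show ContDiff ℝ ∞ (f + g) from
    (show ContDiff ℝ ∞ f from hf).add (show ContDiff ℝ ∞ g from hg)
  smul_mem' c f hf := show ContDiff ℝ ∞ (c • f) from (show ContDiff ℝ ∞ f from hf).const_smul c

theorem deriv_deriv_add {f g : ℝ → ℂ} (hf : ContDiff ℝ ∞ f) (hg : ContDiff ℝ ∞ g) (x : ℝ) :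
    deriv (deriv (f + g)) x = deriv (deriv f) x + deriv (deriv g) x := by
  have h1 : deriv (f + g) = deriv f + deriv g := funext fun y =>
    deriv_add (hf.differentiable (by simp) y) (hg.differentiable (by simp) y)
  have hd : ∀ {f : ℝ → ℂ}, ContDiff ℝ ∞ f → Differentiable ℝ (deriv f) := fun hf =>
    ((contDiff_infty_iff_deriv.1 hf).2).differentiable (by simp)
  rw [h1]
  exact deriv_add (hd hf x) (hd hg x)

theorem deriv_deriv_smul (c : ℝ) (f : ℝ → ℂ) (x : ℝ) :
    deriv (deriv (c • f)) x = c • deriv (deriv f) x := by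
  have h1 : deriv (c • f) = c • deriv f := funext fun y => deriv_const_smul_field c f
  rw [h1]
  exact deriv_const_smul_field c _

/-- `linOp` on smooth functions, as a real linear map. -/
noncomputable def linOpL (V W : ℝ → ℝ) (lam : ℝ) : smoothSubmodule →ₗ[ℝ] (ℝ → ℂ) where
  toFun f := linOp V W lam f
  map_add' f g := by
    funext x
    have := deriv_deriv_add f.2 g.2 x
    simp only [linOp, Submodule.coe_add, Pi.add_apply, this, Complex.add_re, Complex.ofReal_add]
    ring
  map_smul' c f := by
    funext x
    have := deriv_deriv_smul c f x
    simp only [linOp, Submodule.coe_smul, Pi.smul_apply, this, Complex.real_smul, RingHom.id_apply,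
      Complex.re_ofReal_mul, Complex.ofReal_mul]
    ring

theorem contDiff_phiC (k : ℕ) : ContDiff ℝ ∞ (phiC k) :=
  Complex.ofRealCLM.contDiff.comp (contDiff_phi k)

/-- `i φ_k` as a smooth function. -/
noncomputable def smoothIPhi (k : ℕ) : smoothSubmodule :=
  ⟨Complex.I • phiC k, (contDiff_phiC k).const_smul Complex.I⟩

theorem deriv_deriv_phiC (k : ℕ) : deriv (deriv (phiC k)) = fun x =>
    ((-(k * Real.pi) ^ 2 * phi k x : ℝ) : ℂ) := by
  have h1 : deriv (phiC k) = fun x =>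
      ((Real.sqrt 2 * (k * Real.pi) * Real.cos (k * Real.pi * x) : ℝ) : ℂ) :=
    funext fun x => ((hasDerivAt_phi k x).ofReal_comp).deriv
  rw [h1]
  exact funext fun x => ((hasDerivAt_deriv_phi k x).ofReal_comp).deriv

variable (κ : ℝ)

/-- `linOp` with the data that define `Hinf κ`. -/
noncomputable abbrev linOpInf : (ℝ → ℂ) → ℝ → ℂ :=
  linOp (fun _ => 0) (fun x => 2 * κ * phi 1 x ^ 2) (Real.pi ^ 2)

theorem linOpInf_phiC (k : ℕ) :
    linOpInf κ (phiC k) = jacobi κ (fun j => Complex.I • phiC j) k := by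
  funext x
  have h1 := map_jacobi (LinearMap.proj x : (ℝ → ℂ) →ₗ[ℝ] ℂ) κ (fun j => Complex.I • phiC j) k
  have h2 := map_jacobi (LinearMap.toSpanSingleton ℝ ℂ Complex.I) κ (fun j => phi j x) k
  have e : (fun j => (LinearMap.proj x : (ℝ → ℂ) →ₗ[ℝ] ℂ) (Complex.I • phiC j)) =
      fun j => LinearMap.toSpanSingleton ℝ ℂ Complex.I (phi j x) := by
    funext j
    simp [phiC, mul_comm]
  rw [e, ← h2, ← operator_phi] at h1
  simp only [LinearMap.proj_apply] at h1
  rw [h1]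
  simp only [linOpInf, linOp, deriv_deriv_phiC, phiC, LinearMap.toSpanSingleton_apply,
    Complex.real_smul, Complex.ofReal_re]
  push_cast
  ring

/-- The potential acts on the real part only and drops out, so the action is diagonal; the sign is
`i · i = -1`. -/
theorem linOpInf_I_phiC (k : ℕ) :
    linOpInf κ (Complex.I • phiC k) = (-(((k : ℝ) ^ 2 - 1) * Real.pi ^ 2)) • phiC k := by
  funext x
  have h1 : deriv (deriv (Complex.I • phiC k)) x = Complex.I • deriv (deriv (phiC k)) x := by
    have h1 : deriv (Complex.I • phiC k) = Complex.I • deriv (phiC k) :=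
      funext fun y => deriv_const_smul_field _ _
    rw [h1]
    exact deriv_const_smul_field _ _
  have h3 : (Complex.I * (phi k x : ℂ)).re = 0 := by simp
  simp only [linOpInf, linOp, h1, deriv_deriv_phiC, Pi.smul_apply, smul_eq_mul,
    Complex.real_smul, phiC, h3]
  push_cast
  linear_combination (((k : ℂ) ^ 2 * (Real.pi : ℂ) ^ 2 * (phi k x : ℂ)) -
    (Real.pi : ℂ) ^ 2 * (phi k x : ℂ)) * Complex.I_mul_I

theorem coe_jacobi_smoothIPhi (k : ℕ) :
    ((jacobi κ smoothIPhi k : smoothSubmodule) : ℝ → ℂ) =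
      jacobi κ (fun j => Complex.I • phiC j) k :=
  map_jacobi smoothSubmodule.subtype κ smoothIPhi k

/-- `linOp` is additive only where second derivatives add, so the combination is formed in
`smoothSubmodule`, where it is a linear map. -/
theorem linOpInf_jacobi (k : ℕ) : linOpInf κ (jacobi κ (fun j => Complex.I • phiC j) k) =
    jacobi κ (fun j => (-(((j : ℝ) ^ 2 - 1) * Real.pi ^ 2)) • phiC j) k := by
  have := map_jacobi (linOpL (fun _ => 0) (fun x => 2 * κ * phi 1 x ^ 2) (Real.pi ^ 2)) κ
    smoothIPhi k
  rw [← coe_jacobi_smoothIPhi]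
  refine this.trans ?_
  congr 1
  funext j
  exact linOpInf_I_phiC κ j

/-- The span of the functions `φ_k` and `i (-∂ₓ² - π² + 2κφ_1²) φ_k`. -/
noncomputable def sineSpan : Submodule ℝ (ℝ → ℂ) :=
  Submodule.span ℝ (range phiC ∪ range (jacobi κ fun j => Complex.I • phiC j))

theorem phiC_mem_sineSpan (k : ℕ) : phiC k ∈ sineSpan κ :=
  Submodule.subset_span (Or.inl ⟨k, rfl⟩)

/-- Invariance under `linOp`, phrased through `smoothSubmodule` so that it can be checked on
generators. -/
theorem sineSpan_le : sineSpan κ ≤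
    ((sineSpan κ).comap (linOpL (fun _ => 0) (fun x => 2 * κ * phi 1 x ^ 2) (Real.pi ^ 2))).map
      smoothSubmodule.subtype := by
  refine Submodule.span_le.2 ?_
  rintro _ (⟨k, rfl⟩ | ⟨k, rfl⟩)
  · refine ⟨⟨phiC k, contDiff_phiC k⟩, ?_, rfl⟩
    change linOpInf κ (phiC k) ∈ sineSpan κ
    rw [linOpInf_phiC]
    exact Submodule.subset_span (Or.inr ⟨k, rfl⟩)
  · refine ⟨jacobi κ smoothIPhi k, ?_, coe_jacobi_smoothIPhi κ k⟩
    change linOpInf κ (jacobi κ smoothIPhi k : smoothSubmodule) ∈ sineSpan κ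
    rw [coe_jacobi_smoothIPhi, linOpInf_jacobi]
    exact jacobi_mem _ (fun j => Submodule.smul_mem _ _ (phiC_mem_sineSpan κ j)) k

theorem linOpInf_mem_sineSpan {f : ℝ → ℂ} (hf : f ∈ sineSpan κ) : linOpInf κ f ∈ sineSpan κ := by
  obtain ⟨g, hg, rfl⟩ := sineSpan_le κ hf
  exact hg

theorem cos_mul_phi_one :
    (fun x => ((Real.cos (Real.pi * x) * phi 1 x : ℝ) : ℂ)) = (1 / 2 : ℝ) • phiC 2 := by
  funext x
  have : phi 2 x = 2 * (Real.cos (Real.pi * x) * phi 1 x) := by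
    simp only [phi, Nat.cast_ofNat, Nat.cast_one, one_mul]
    rw [mul_assoc 2, Real.sin_two_mul]; ring
  simp only [Pi.smul_apply, phiC, this, Complex.real_smul]
  push_cast
  ring

theorem Hinf_le_sineSpan : Hinf κ ≤ sineSpan κ := by
  refine iSup_le fun n => ?_
  induction n with
  | zero =>
    refine Submodule.span_le.2 ?_
    rintro _ ⟨j, rfl⟩
    fin_cases j
    · have := phiC_mem_sineSpan κ 1
      unfold phiC at this
      simpa using this
    · have := (sineSpan κ).smul_mem (1 / 2 : ℝ) (phiC_mem_sineSpan κ 2)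
      rw [← cos_mul_phi_one] at this
      simpa using this
  | succ n ih =>
    refine Submodule.span_le.2 ?_
    rintro _ ⟨f, hf, g, hg, rfl⟩
    exact (sineSpan κ).add_mem (ih hf) (linOpInf_mem_sineSpan κ (ih hg))

theorem linOpInf_mem_Hinf {f : ℝ → ℂ} (hf : f ∈ Hinf κ) : linOpInf κ f ∈ Hinf κ := by
  rw [Hinf, mem_satSpaceInf] at hf ⊢
  obtain ⟨n, hn⟩ := hf
  exact ⟨n + 1, Submodule.subset_span ⟨0, Submodule.zero_mem _, f, hn, (zero_add _).symm⟩⟩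

variable {κ}

/-- Two applications of `linOp` to `φ_{k+1}` give a combination of `φ_{k-1}`, `φ_{k+1}` and
`φ_{k+3}`. The coefficient of the last is a nonzero multiple of `κ`, so it can be solved for; this
is where `κ ≠ 0` enters. -/
theorem phiC_mem_Hinf (hκ : κ ≠ 0) (k : ℕ) : phiC k ∈ Hinf κ := by
  have hbase : ∀ j : Fin 2, (fun x => (((![fun _ => 1, fun x => Real.cos (Real.pi * x)] :
      Fin 2 → ℝ → ℝ) j x * phi 1 x : ℝ) : ℂ)) ∈ Hinf κ := fun j =>
    (mem_satSpaceInf _ _ _ _ _ _).2 ⟨0, Submodule.subset_span ⟨j, rfl⟩⟩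
  induction k using Nat.strong_induction_on with
  | _ n ih =>
    match n, ih with
    | 0, _ =>
      have : phiC 0 = 0 := funext fun x => by simp [phiC, phi_zero]
      rw [this]; exact Submodule.zero_mem _
    | 1, _ =>
      unfold phiC
      simpa using hbase 0
    | 2, _ =>
      have := (Hinf κ).smul_mem (2 : ℝ) (hbase 1)
      simp only [Matrix.cons_val_one, Matrix.cons_val_fin_one] at this
      rw [cos_mul_phi_one, smul_smul] at this
      simpa using this
    | k + 3, ih =>
      have h1 := ih (k + 1) (by omega)
      have h2 := linOpInf_mem_Hinf κ (linOpInf_mem_Hinf κ h1)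
      rw [linOpInf_phiC, linOpInf_jacobi] at h2
      set v : ℕ → ℝ → ℂ := fun j => (-(((j : ℝ) ^ 2 - 1) * Real.pi ^ 2)) • phiC j with hv
      have hb : shiftBack v (k + 1) ∈ Hinf κ := by
        match k, ih with
        | 0, ih => exact (Hinf κ).neg_mem ((Hinf κ).smul_mem _ (ih 1 (by omega)))
        | k + 1, ih => exact (Hinf κ).smul_mem _ (ih k (by omega))
      have h3 : v (k + 1) ∈ Hinf κ := (Hinf κ).smul_mem _ h1
      have h4 : κ • (v (k + 1 + 2) + shiftBack v (k + 1)) ∈ Hinf κ := by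
        have := (Hinf κ).sub_mem ((Hinf κ).smul_mem
          ((((k + 1 : ℕ) : ℝ) ^ 2 - 1) * Real.pi ^ 2 + 2 * κ) h3) h2
        rwa [jacobi, sub_sub_cancel] at this
      rw [Submodule.smul_mem_iff _ hκ, Submodule.add_mem_iff_left _ hb] at h4
      -- The remaining factor `-((k + 3)² - 1) π²` is nonzero.
      refine (Submodule.smul_mem_iff _ ?_).1 h4
      have : (0 : ℝ) ≤ k := k.cast_nonneg
      have hpi := Real.pi_ne_zero
      push_cast
      refine neg_ne_zero.2 (mul_ne_zero ?_ (pow_ne_zero 2 hpi))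
      nlinarith

theorem Hinf_eq_sineSpan (hκ : κ ≠ 0) : Hinf κ = sineSpan κ := by
  refine le_antisymm (Hinf_le_sineSpan κ) (Submodule.span_le.2 ?_)
  rintro _ (⟨k, rfl⟩ | ⟨k, rfl⟩)
  · exact phiC_mem_Hinf hκ k
  · rw [← linOpInf_phiC]
    exact linOpInf_mem_Hinf κ (phiC_mem_Hinf hκ k)

end

/-! ### Functionals on `H³_(0)` and the closure of the span -/

section

theorem memLp_integrable {f : ℝ → ℂ} (hf : MemLp f 2 muI) : Integrable f muI :=
  hf.integrable (by norm_num)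

theorem sineCoeff_eq_integral (k : ℕ) (f : L2I) : sineCoeff k f = ∫ x, f x * (phi k x : ℂ) ∂muI := by
  rw [sineCoeff, L2.inner_def]
  refine integral_congr_ae ?_
  filter_upwards [(memLp_phi k).coeFn_toLp] with x hx
  rw [phiL2, hx, RCLike.inner_apply]
  simp

theorem integrable_mul_phi (k : ℕ) (f : L2I) :
    Integrable (fun x => f x * (phi k x : ℂ)) muI := by
  refine (memLp_integrable (Lp.memLp f)).mul_bdd (c := Real.sqrt 2)
    (Complex.continuous_ofReal.comp (contDiff_phi k).continuous).aestronglyMeasurable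
    (Filter.Eventually.of_forall fun x => ?_)
  rw [Complex.norm_real]
  exact abs_phi_le k x

theorem sineCoeff_re (k : ℕ) (f : L2I) : (sineCoeff k f).re = ∫ x, (f x).re * phi k x ∂muI := by
  rw [sineCoeff_eq_integral, ← RCLike.re_eq_complex_re, ← integral_re (integrable_mul_phi k f)]
  simp

theorem sineCoeff_im (k : ℕ) (f : L2I) : (sineCoeff k f).im = ∫ x, (f x).im * phi k x ∂muI := by
  rw [sineCoeff_eq_integral, ← RCLike.im_eq_complex_im, ← integral_im (integrable_mul_phi k f)]
  simp

/-- An element of `L²(I; ℂ)` is determined by its sine coefficients. -/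
theorem eq_of_sineCoeff_eq {f g : L2I} (h : ∀ k, sineCoeff k f = sineCoeff k g) : f = g := by
  rw [← sub_eq_zero]
  have h0 : ∀ k, sineCoeff k (f - g) = 0 := fun k => by
    rw [sineCoeff, inner_sub_right, sub_eq_zero]; exact h k
  have hi := memLp_integrable (Lp.memLp (f - g))
  have hre := ae_eq_zero_of_integral_mul_phi (f := fun x => ((f - g : L2I) x).re) hi.re
    fun k => by rw [← sineCoeff_re, h0]; rfl
  have him := ae_eq_zero_of_integral_mul_phi (f := fun x => ((f - g : L2I) x).im) hi.im
    fun k => by rw [← sineCoeff_im, h0]; rfl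
  rw [Lp.eq_zero_iff_ae_eq_zero]
  filter_upwards [hre, him] with x h1 h2
  exact Complex.ext h1 h2

theorem H3.ext_toL2 {f g : H3} (h : H3.toL2 f = H3.toL2 g) : f = g := Subtype.ext h

theorem sineCoeff_phiL2 (j k : ℕ) :
    sineCoeff j (phiL2 k) = if j = k ∧ k ≠ 0 then 1 else 0 := by
  have hae := (memLp_phi k).coeFn_toLp
  refine Complex.ext ?_ ?_
  · rw [sineCoeff_re, show (if j = k ∧ k ≠ 0 then (1 : ℂ) else 0).re =
      if j = k ∧ k ≠ 0 then 1 else 0 by split_ifs <;> simp, ← integral_phi_mul_phi]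
    refine integral_congr_ae ?_
    filter_upwards [hae] with x hx
    rw [phiL2, hx, Complex.ofReal_re, mul_comm]
  · rw [sineCoeff_im, show (if j = k ∧ k ≠ 0 then (1 : ℂ) else 0).im = 0 by split_ifs <;> simp]
    refine integral_eq_zero_of_ae ?_
    filter_upwards [hae] with x hx
    rw [phiL2, hx, Complex.ofReal_im, zero_mul, Pi.zero_apply]

theorem sineCoeff_smul (a : ℂ) (k : ℕ) (f : L2I) : sineCoeff k (a • f) = a * sineCoeff k f := by
  rw [sineCoeff, inner_smul_right]; rfl

theorem threeHalvesCoeff_smul_phiL2 (a : ℂ) (k : ℕ) :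
    threeHalvesCoeff (a • phiL2 (k + 1)) =
      lp.single (E := fun _ : ℕ => ℂ) 2 k (((((k + 1 : ℕ) : ℝ) * Real.pi) ^ 3 : ℝ) * a) := by
  funext n
  rw [threeHalvesCoeff, sineCoeff_smul, sineCoeff_phiL2, lp.coeFn_single]
  by_cases h : n = k
  · subst h; simp
  · simp [h]

theorem phiL2_zero : phiL2 0 = 0 :=
  eq_of_sineCoeff_eq fun k => by
    rw [sineCoeff_phiL2, sineCoeff, inner_zero_right]; simp

theorem smul_phiL2_mem (a : ℂ) (k : ℕ) : a • phiL2 k ∈ H3Submodule := by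
  match k with
  | 0 => rw [phiL2_zero, smul_zero]; exact H3Submodule.zero_mem
  | k + 1 =>
    change Memℓp (threeHalvesCoeff _) 2
    rw [threeHalvesCoeff_smul_phiL2]
    exact lp.memℓp _

/-- `a φ_k` as an element of `H³_(0)`. -/
noncomputable def phiH3 (a : ℂ) (k : ℕ) : H3 := ⟨a • phiL2 k, smul_phiL2_mem a k⟩

theorem toL2_phiH3 (a : ℂ) (k : ℕ) : H3.toL2 (phiH3 a k) = a • phiL2 k := rfl

theorem phiH3_zero (a : ℂ) : phiH3 a 0 = 0 :=
  H3.ext_toL2 (by rw [toL2_phiH3, phiL2_zero, smul_zero, map_zero])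

theorem threeHalves_phiH3 (a : ℂ) (k : ℕ) : H3.threeHalves (phiH3 a (k + 1)) =
    lp.single (E := fun _ : ℕ => ℂ) 2 k (((((k + 1 : ℕ) : ℝ) * Real.pi) ^ 3 : ℝ) * a) :=
  Subtype.ext (threeHalvesCoeff_smul_phiL2 a k)

theorem norm_H3 (f : H3) : ‖f‖ = ‖H3.threeHalves f‖ := rfl

/-- Convergence in `H³_(0)` can thus be checked in `ℓ²`. -/
theorem isInducing_threeHalves : Topology.IsInducing H3.threeHalves := ⟨rfl⟩

/-- The sine series of an element of `H³_(0)` converges in `H³_(0)`. -/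
theorem hasSum_H3 (f : H3) :
    HasSum (fun n => phiH3 (sineCoeff (n + 1) (H3.toL2 f)) (n + 1)) f := by
  have h := lp.hasSum_single (E := fun _ : ℕ => ℂ) (p := 2) (by norm_num) (H3.threeHalves f)
  rw [HasSum, isInducing_threeHalves.tendsto_nhds_iff]
  refine Filter.Tendsto.congr (fun s => ?_) h
  rw [Function.comp, map_sum]
  refine Finset.sum_congr rfl fun n _ => ?_
  rw [threeHalves_phiH3]
  rfl

theorem phiH3_eq (a : ℂ) (k : ℕ) : phiH3 a k = a.re • phiH3 1 k + a.im • phiH3 Complex.I k := by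
  refine H3.ext_toL2 (eq_of_sineCoeff_eq fun j => ?_)
  have hs : ∀ (r : ℝ) (f : L2I), sineCoeff j (r • f) = r * sineCoeff j f := fun r f => by
    rw [← sineCoeff_smul]; rfl
  have ha : ∀ f g : L2I, sineCoeff j (f + g) = sineCoeff j f + sineCoeff j g := fun f g =>
    inner_add_right _ _ _
  rw [map_add, map_smul, map_smul, toL2_phiH3, toL2_phiH3, toL2_phiH3, ha, hs, hs, sineCoeff_smul,
    sineCoeff_smul, sineCoeff_smul]
  nth_rw 1 [← Complex.re_add_im a]
  ring

/-- Continuous functionals on `H³_(0)` are determined by their values at `φ_k` and `i φ_k`. -/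
theorem functional_ext {l m : H3 →L[ℝ] ℝ} (h1 : ∀ k, l (phiH3 1 k) = m (phiH3 1 k))
    (h2 : ∀ k, l (phiH3 Complex.I k) = m (phiH3 Complex.I k)) : l = m := by
  ext f
  refine ((hasSum_H3 f).mapL l).unique (((hasSum_H3 f).mapL m).congr_fun fun n => ?_)
  rw [phiH3_eq]
  simp only [map_add, map_smul, h1, h2]

/-- The source of the cubic growth bound for the values of a continuous functional at `i φ_k`. -/
theorem norm_phiH3_le (k : ℕ) :
    ‖phiH3 Complex.I k‖ ≤ Real.pi ^ 3 * ((k : ℝ) + 1) ^ 3 := by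
  have hpi := Real.pi_pos
  match k with
  | 0 => rw [phiH3_zero, norm_zero]; positivity
  | k + 1 =>
    rw [norm_H3, threeHalves_phiH3, lp.norm_single (by norm_num), norm_mul, Complex.norm_I, mul_one,
      Complex.norm_real, Real.norm_of_nonneg (by positivity), mul_pow, mul_comm]
    gcongr
    linarith

variable (κ : ℝ)

/-- The span in `H³_(0)` of the functions `φ_k` and `i (-∂ₓ² - π² + 2κφ_1²) φ_k`. -/
noncomputable def sineSpanH3 : Submodule ℝ H3 :=
  Submodule.span ℝ (range (phiH3 1) ∪ range (jacobi κ (phiH3 Complex.I)))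

/-- The pairs of an element of `H³_(0)` and a representative of it. -/
def aeGraph : Submodule ℝ (H3 × (ℝ → ℂ)) where
  carrier := {p | ⇑(H3.toL2 p.1) =ᵐ[muI] p.2}
  zero_mem' := by
    change ⇑(H3.toL2 0) =ᵐ[muI] 0
    rw [map_zero]
    exact Lp.coeFn_zero ℂ 2 muI
  add_mem' := by
    intro p q hp hq
    change ⇑(H3.toL2 (p.1 + q.1)) =ᵐ[muI] p.2 + q.2
    rw [map_add]
    exact (Lp.coeFn_add _ _).trans (Filter.EventuallyEq.add hp hq)
  smul_mem' := by
    intro c p hp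
    change ⇑(H3.toL2 (c • p.1)) =ᵐ[muI] c • p.2
    rw [map_smul]
    exact (Lp.coeFn_smul c _).trans
      ((show ⇑(H3.toL2 p.1) =ᵐ[muI] p.2 from hp).const_smul c)

theorem phiH3_mem_aeGraph (a : ℂ) (k : ℕ) : (phiH3 a k, a • phiC k) ∈ aeGraph := by
  change ⇑(H3.toL2 (phiH3 a k)) =ᵐ[muI] a • phiC k
  rw [toL2_phiH3]
  exact (Lp.coeFn_smul a _).trans (((memLp_phi k).coeFn_toLp).const_smul a)

theorem jacobi_mem_aeGraph (k : ℕ) :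
    (jacobi κ (phiH3 Complex.I) k, jacobi κ (fun j => Complex.I • phiC j) k) ∈ aeGraph := by
  have h := jacobi_mem aeGraph (κ := κ) (phiH3_mem_aeGraph Complex.I) k
  have h1 := map_jacobi (LinearMap.fst ℝ H3 (ℝ → ℂ)) κ
    (fun j => (phiH3 Complex.I j, Complex.I • phiC j)) k
  have h2 := map_jacobi (LinearMap.snd ℝ H3 (ℝ → ℂ)) κ
    (fun j => (phiH3 Complex.I j, Complex.I • phiC j)) k
  convert! h using 1
  exact Prod.ext h1.symm h2.symm

/-- The functions with such a representative form the projection of a submodule of pairs, so the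
generators suffice. -/
theorem exists_mem_sineSpanH3 {h : ℝ → ℂ} (hh : h ∈ sineSpan κ) :
    ∃ f ∈ sineSpanH3 κ, ⇑(H3.toL2 f) =ᵐ[muI] h := by
  have hle : sineSpan κ ≤ ((sineSpanH3 κ).comap (LinearMap.fst ℝ H3 (ℝ → ℂ)) ⊓ aeGraph).map
      (LinearMap.snd ℝ H3 (ℝ → ℂ)) := by
    refine Submodule.span_le.2 ?_
    rintro _ (⟨k, rfl⟩ | ⟨k, rfl⟩)
    · refine ⟨(phiH3 1 k, phiC k), ⟨Submodule.subset_span (Or.inl ⟨k, rfl⟩), ?_⟩, rfl⟩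
      simpa using phiH3_mem_aeGraph 1 k
    · exact ⟨_, ⟨Submodule.subset_span (Or.inr ⟨k, rfl⟩), jacobi_mem_aeGraph κ k⟩, rfl⟩
  obtain ⟨p, ⟨hp1, hp2⟩, rfl⟩ := hle hh
  exact ⟨p.1, hp1, hp2⟩

variable {κ}

theorem inH3_Hinf (hκ : κ ≠ 0) : inH3 (Hinf κ) = sineSpanH3 κ := by
  rw [Hinf_eq_sineSpan hκ]
  refine le_antisymm ?_ (Submodule.span_le.2 ?_)
  · rintro f ⟨h, hh, hf⟩
    obtain ⟨g, hg, hgh⟩ := exists_mem_sineSpanH3 κ hh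
    rwa [H3.ext_toL2 (Lp.ext (hf.trans hgh.symm))]
  · rintro _ (⟨k, rfl⟩ | ⟨k, rfl⟩)
    · refine ⟨phiC k, phiC_mem_sineSpan κ k, ?_⟩
      have := phiH3_mem_aeGraph 1 k
      rw [one_smul] at this
      exact this
    · exact ⟨_, Submodule.subset_span (Or.inr ⟨k, rfl⟩), jacobi_mem_aeGraph κ k⟩

/-- A linear functional vanishes on `sineSpanH3 κ` if and only if it vanishes at the `φ_k` and its
values at the `i φ_k` solve the recurrence. -/
theorem forall_sineSpanH3_eq_zero_iff (l : H3 →ₗ[ℝ] ℝ) : (∀ f ∈ sineSpanH3 κ, l f = 0) ↔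
    (∀ k, l (phiH3 1 k) = 0) ∧ ∀ k, jacobi κ (fun j => l (phiH3 Complex.I j)) k = 0 := by
  constructor
  · intro h
    refine ⟨fun k => h _ (Submodule.subset_span (Or.inl ⟨k, rfl⟩)), fun k => ?_⟩
    rw [← map_jacobi]
    exact h _ (Submodule.subset_span (Or.inr ⟨k, rfl⟩))
  · rintro ⟨h1, h2⟩
    have hle : sineSpanH3 κ ≤ LinearMap.ker l := by
      refine Submodule.span_le.2 ?_
      rintro _ (⟨k, rfl⟩ | ⟨k, rfl⟩)
      · exact h1 k
      · exact (map_jacobi l κ _ k).trans (h2 k)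
    exact fun f hf => hle hf

theorem memℓp_two_of_norm_le {w : ℕ → ℂ} {C : ℝ} (h : ∀ n : ℕ, ‖w n‖ ≤ C / ((n : ℝ) + 1)) :
    Memℓp w 2 := by
  refine memℓp_gen ?_
  simp only [ENNReal.toReal_ofNat, Real.rpow_ofNat]
  refine Summable.of_nonneg_of_le (fun n => by positivity) (fun n => ?_)
    (summable_inv_sq.mul_left (C ^ 2))
  calc ‖w n‖ ^ 2 ≤ (C / ((n : ℝ) + 1)) ^ 2 := pow_le_pow_left₀ (norm_nonneg _) (h n) 2
    _ = _ := by rw [div_pow]; ring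

/-- The continuous functional with prescribed rapidly decaying values at `i φ_k`. -/
theorem exists_functional {c : ℕ → ℝ} (hc0 : c 0 = 0)
    (hc : ∃ C, ∀ k : ℕ, ((k : ℝ) + 1) ^ 5 * |c k| ≤ C) :
    ∃ L : H3 →L[ℝ] ℝ, (∀ k, L (phiH3 1 k) = 0) ∧ ∀ k, L (phiH3 Complex.I k) = c k := by
  obtain ⟨C, hC⟩ := hc
  have hpi := Real.pi_pos
  -- The Riesz vector of the functional: division by `(kπ)³` undoes the weight in `H3.threeHalves`,
  -- and the factor `i` makes the real part of the inner product select the imaginary part.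
  have hw : Memℓp (fun n : ℕ => Complex.I * (c (n + 1) / (((n + 1 : ℕ) : ℝ) * Real.pi) ^ 3 : ℝ)) 2 := by
    refine memℓp_two_of_norm_le (C := C) fun n => ?_
    have hn : (0 : ℝ) ≤ n := n.cast_nonneg
    have h1 : (1 : ℝ) ≤ (((n + 1 : ℕ) : ℝ) * Real.pi) ^ 3 := by
      refine one_le_pow₀ ?_
      push_cast
      nlinarith [Real.pi_gt_three]
    rw [norm_mul, Complex.norm_I, one_mul, Complex.norm_real, norm_div,
      Real.norm_of_nonneg (r := (((n + 1 : ℕ) : ℝ) * Real.pi) ^ 3) (by positivity),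
      le_div_iff₀ (by positivity), Real.norm_eq_abs]
    have := hC (n + 1)
    push_cast at this
    calc _ ≤ |c (n + 1)| * ((n : ℝ) + 1) := by gcongr; exact div_le_self (abs_nonneg _) h1
      _ ≤ |c (n + 1)| * ((n : ℝ) + 1 + 1) ^ 5 := by
          gcongr
          calc (n : ℝ) + 1 ≤ (n : ℝ) + 1 + 1 := by linarith
            _ ≤ _ := le_self_pow₀ (by linarith) (by norm_num)
      _ ≤ C := by linarith
  set w : lp (fun _ : ℕ => ℂ) 2 := ⟨_, hw⟩ with hwdef
  let T : H3 →L[ℝ] lp (fun _ : ℕ => ℂ) 2 :=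
    H3.threeHalves.mkContinuous 1 fun f => by rw [one_mul, norm_H3]
  let L : H3 →L[ℝ] ℝ := Complex.reCLM.comp (((innerSL ℂ w).restrictScalars ℝ).comp T)
  have hL : ∀ f, L f = (inner ℂ w (H3.threeHalves f)).re := fun f => rfl
  have hLp : ∀ (a : ℂ) (k : ℕ), L (phiH3 a k) = c k * a.im := by
    intro a k
    match k with
    | 0 => rw [phiH3_zero, map_zero, hc0, zero_mul]
    | k + 1 =>
      rw [hL, threeHalves_phiH3, lp.inner_single_right, hwdef]
      have hk : (((k + 1 : ℕ) : ℝ) * Real.pi) ^ 3 ≠ 0 := by positivity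
      simp only [RCLike.inner_apply, map_mul, Complex.conj_I, Complex.conj_ofReal]
      set s := (((k + 1 : ℕ) : ℝ) * Real.pi) ^ 3
      simp
      field_simp
  exact ⟨L, fun k => by simp [hLp], fun k => by simp [hLp]⟩

/-- Functionals that vanish on `sineSpanH3 κ` are multiples of any of them. -/
theorem functional_proportional {c : ℕ → ℝ} (hc0 : c 0 = 0) (hc : ∀ k, jacobi κ c k = 0)
    (hcb : ∃ C, ∀ k : ℕ, |c k| ≤ C * ((k : ℝ) + 1) ^ 3) (hne : ∃ k, c k ≠ 0) {L : H3 →L[ℝ] ℝ}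
    (hL1 : ∀ k, L (phiH3 1 k) = 0) (hL2 : ∀ k, L (phiH3 Complex.I k) = c k) {l : H3 →L[ℝ] ℝ}
    (hl : ∀ f ∈ sineSpanH3 κ, l f = 0) : ∃ t : ℝ, l = t • L := by
  obtain ⟨h1, h2⟩ := (forall_sineSpanH3_eq_zero_iff (l : H3 →ₗ[ℝ] ℝ)).1 hl
  obtain ⟨t, ht⟩ := solution_proportional hc0 hc hcb (d := fun k => l (phiH3 Complex.I k))
    (by rw [phiH3_zero, map_zero]) h2 ⟨‖l‖ * Real.pi ^ 3, fun k => by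
      rw [mul_assoc, ← Real.norm_eq_abs]
      exact (l.le_opNorm _).trans (by gcongr; exact norm_phiH3_le k)⟩ hne
  refine ⟨t, functional_ext (fun k => ?_) fun k => ?_⟩
  · rw [smul_apply, hL1, smul_zero]; exact h1 k
  · rw [smul_apply, hL2]; exact ht k

/-- A point of `ker L` outside the closure would be separated from it by a functional that vanishes
on the span. That functional is a multiple of `L`, hence zero at the point, a contradiction. -/
theorem topologicalClosure_sineSpanH3 {c : ℕ → ℝ} (hc0 : c 0 = 0) (hc : ∀ k, jacobi κ c k = 0)
    (hcb : ∃ C, ∀ k : ℕ, |c k| ≤ C * ((k : ℝ) + 1) ^ 3) (hne : ∃ k, c k ≠ 0) {L : H3 →L[ℝ] ℝ}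
    (hL1 : ∀ k, L (phiH3 1 k) = 0) (hL2 : ∀ k, L (phiH3 Complex.I k) = c k) :
    (sineSpanH3 κ).topologicalClosure = LinearMap.ker (L : H3 →ₗ[ℝ] ℝ) := by
  refine le_antisymm (Submodule.topologicalClosure_minimal _ (fun f hf => ?_) L.isClosed_ker)
    fun f hf => ?_
  · refine (forall_sineSpanH3_eq_zero_iff (κ := κ) (L : H3 →ₗ[ℝ] ℝ)).2 ⟨hL1, fun k => ?_⟩ f hf
    rw [← hc k]
    congr 1
    exact funext hL2
  · by_contra hfm
    obtain ⟨l, s, hls, hsf⟩ := geometric_hahn_banach_closed_point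
      (sineSpanH3 κ).topologicalClosure.convex (sineSpanH3 κ).isClosed_topologicalClosure hfm
    have hl0 : ∀ g ∈ sineSpanH3 κ, l g = 0 := by
      intro g hg
      by_contra hlg
      -- A functional bounded above by `s` on a subspace vanishes there: this multiple of `g` would
      -- have the value `s + 1`.
      have := hls (((s + 1) / l g) • g)
        (Submodule.smul_mem _ _ ((sineSpanH3 κ).le_topologicalClosure hg))
      rw [map_smul, smul_eq_mul, div_mul_cancel₀ _ hlg] at this
      linarith
    obtain ⟨t, rfl⟩ := functional_proportional hc0 hc hcb hne hL1 hL2 hl0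
    have h0 := hls 0 (Submodule.zero_mem _)
    have hf' : L f = 0 := hf
    rw [map_zero] at h0
    rw [smul_apply, hf', smul_zero] at hsf
    linarith

/-- The functional `⟨z, ·⟩_{L²}` on `H³_(0)`. -/
noncomputable def l2Functional (z : L2I) : H3 →ₗ[ℝ] ℝ where
  toFun h := l2Inner z (H3.toL2 h)
  map_add' f g := by rw [map_add]; simp [l2Inner, inner_add_left]
  map_smul' r f := by
    have : inner ℂ (r • H3.toL2 f) z = (r : ℂ) * inner ℂ (H3.toL2 f) z := by
      have h := inner_smul_left (𝕜 := ℂ) (H3.toL2 f) z (r : ℂ)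
      rw [Complex.conj_ofReal] at h
      exact h
    rw [map_smul, l2Inner, this]
    simp [l2Inner]

theorem l2Functional_phiH3 (z : L2I) (a : ℂ) (k : ℕ) :
    l2Functional z (phiH3 a k) = (starRingEnd ℂ a * sineCoeff k z).re := by
  change (inner ℂ (H3.toL2 (phiH3 a k)) z).re = _
  rw [toL2_phiH3, inner_smul_left]; rfl

theorem forall_l2Inner_eq_zero_iff (z : L2I) :
    (∀ h ∈ sineSpanH3 κ, l2Inner z (H3.toL2 h) = 0) ↔
      (∀ k, (sineCoeff k z).re = 0) ∧ ∀ k, jacobi κ (fun j => (sineCoeff j z).im) k = 0 := by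
  rw [show (∀ h ∈ sineSpanH3 κ, l2Inner z (H3.toL2 h) = 0) ↔
    ∀ h ∈ sineSpanH3 κ, l2Functional z h = 0 from Iff.rfl, forall_sineSpanH3_eq_zero_iff]
  simp [l2Functional_phiH3]

/-- The coefficients are even bounded; the cubic form is the one that `rapid_decay` takes. -/
theorem abs_sineCoeff_im_le (z : L2I) :
    ∃ C, ∀ k : ℕ, |(sineCoeff k z).im| ≤ C * ((k : ℝ) + 1) ^ 3 := by
  refine ⟨(∫ x, ‖z x‖ ∂muI) * Real.sqrt 2, fun k => ?_⟩
  have hI : 0 ≤ ∫ x, ‖z x‖ ∂muI := integral_nonneg fun x => norm_nonneg _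
  have h1 : |(sineCoeff k z).im| ≤ (∫ x, ‖z x‖ ∂muI) * Real.sqrt 2 := by
    refine (Complex.abs_im_le_norm _).trans ?_
    rw [sineCoeff_eq_integral, ← integral_mul_const]
    refine norm_integral_le_of_norm_le ((memLp_integrable (Lp.memLp z)).norm.mul_const _)
      (Filter.Eventually.of_forall fun x => ?_)
    rw [norm_mul, Complex.norm_real]
    gcongr
    exact abs_phi_le k x
  refine h1.trans (le_mul_of_one_le_right (by positivity) (one_le_pow₀ ?_))
  have : (0 : ℝ) ≤ k := k.cast_nonneg
  linarith

/-- The properties of the sine coefficients of an eigenfunction, and its membership in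
`H³_(0)`. -/
theorem IsEigenfunction.exists_H3 {u : ℝ → ℝ} (h : IsEigenfunction κ 0 u) :
    ∃ ψ : H3, ⇑(H3.toL2 ψ) =ᵐ[muI] (fun x => Complex.I * (u x : ℂ)) ∧
      (∀ k, (sineCoeff k (H3.toL2 ψ)).re = 0) ∧
      (∀ k, jacobi κ (fun j => (sineCoeff j (H3.toL2 ψ)).im) k = 0) ∧
      ∃ k, (sineCoeff k (H3.toL2 ψ)).im ≠ 0 := by
  have hj := h.jacobi_eq_zero
  obtain ⟨hu0, u1, u2, hd, -⟩ := h
  have hm : MemLp (fun x => Complex.I * (u x : ℂ)) 2 muI := (hd.memLp.ofReal).const_mul Complex.I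
  set z : L2I := hm.toLp _ with hz
  have hzae : ⇑z =ᵐ[muI] fun x => Complex.I * (u x : ℂ) := hm.coeFn_toLp
  have hre : ∀ k, (sineCoeff k z).re = 0 := fun k => by
    rw [sineCoeff_re]
    refine integral_eq_zero_of_ae ?_
    filter_upwards [hzae] with x hx
    rw [hx]; simp
  have him : ∀ k, (sineCoeff k z).im = ∫ x, u x * phi k x ∂muI := fun k => by
    rw [sineCoeff_im]
    refine integral_congr_ae ?_
    filter_upwards [hzae] with x hx
    rw [hx]; simp
  have hjz : ∀ k, jacobi κ (fun j => (sineCoeff j z).im) k = 0 := by simpa only [him] using hj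
  -- A fifth-power decay outweighs the factor `(kπ)³` of the norm and leaves square-summable terms.
  obtain ⟨C, hC⟩ := rapid_decay hjz (abs_sineCoeff_im_le z)
  have hmem : z ∈ H3Submodule := by
    refine memℓp_two_of_norm_le (C := Real.pi ^ 3 * C) fun n => ?_
    have hn : (0 : ℝ) ≤ n := n.cast_nonneg
    have hpi := Real.pi_pos
    have e : sineCoeff (n + 1) z = Complex.I * ((sineCoeff (n + 1) z).im : ℝ) := by
      rw [← Complex.re_add_im (sineCoeff (n + 1) z), hre]
      simp [mul_comm]
    have hCn := hC (n + 1)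
    push_cast at hCn
    rw [threeHalvesCoeff, e, norm_smul, norm_mul, Complex.norm_I, one_mul, Complex.norm_real,
      Real.norm_of_nonneg (by positivity), le_div_iff₀ (by positivity), Real.norm_eq_abs]
    push_cast
    calc (((n : ℝ) + 1) * Real.pi) ^ 3 * |(sineCoeff (n + 1) z).im| * ((n : ℝ) + 1) =
          Real.pi ^ 3 * (((n : ℝ) + 1) ^ 4 * |(sineCoeff (n + 1) z).im|) := by ring
      _ ≤ Real.pi ^ 3 * (((n : ℝ) + 1 + 1) ^ 5 * |(sineCoeff (n + 1) z).im|) := by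
          gcongr
          calc ((n : ℝ) + 1) ^ 4 ≤ ((n : ℝ) + 1 + 1) ^ 4 := by gcongr; linarith
            _ ≤ _ := pow_le_pow_right₀ (by linarith) (by norm_num)
      _ ≤ _ := by gcongr
  refine ⟨⟨z, hmem⟩, hzae, hre, hjz, ?_⟩
  -- If all coefficients vanished, completeness would give `u = 0` almost everywhere.
  by_contra! hall
  refine hu0 (ae_eq_zero_of_integral_mul_phi (hd.memLp.integrable (by norm_num)) fun k => ?_)
  rw [← him]
  exact hall k

end

end NLS

theorem corollary3p4 (κ : ℝ) (hκ : κ ∈ NLS.exceptionalSet) (hκ0 : κ ≠ 0) :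
    (∀ h ∈ NLS.Hinf κ, ∃ f : NLS.H3, ⇑(NLS.H3.toL2 f) =ᵐ[NLS.muI] h) ∧
    Module.finrank ℝ (NLS.H3 ⧸ (NLS.inH3 (NLS.Hinf κ)).topologicalClosure) = 1 ∧
    ∃ k : ℕ, 1 ≤ k ∧ NLS.IsKthEigenvalue κ k 0 ∧
      ∀ u : ℝ → ℝ, NLS.IsEigenfunction κ 0 u →
        ∃ ψ : NLS.H3, ⇑(NLS.H3.toL2 ψ) =ᵐ[NLS.muI] (fun x => Complex.I * (u x : ℂ)) ∧
          {z : NLS.H3 | ∀ h ∈ NLS.inH3 (NLS.Hinf κ),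
              NLS.l2Inner (NLS.H3.toL2 z) (NLS.H3.toL2 h) = 0}
            = (Submodule.span ℝ {ψ} : Set NLS.H3) := by
  open NLS in
  have hzero : ∀ z : L2I, (sineCoeff 0 z).im = 0 := fun z => by
    rw [sineCoeff, phiL2_zero, inner_zero_left]; rfl
  rw [inH3_Hinf hκ0]
  obtain ⟨k, hk⟩ := hκ
  refine ⟨fun h hh => ?_, ?_, k, ?_, hk, fun u hu => ?_⟩
  · obtain ⟨f, -, hf⟩ := exists_mem_sineSpanH3 κ (Hinf_le_sineSpan κ hh)
    exact ⟨f, hf⟩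
  · obtain ⟨u, hu⟩ := hk.1
    obtain ⟨ψ, -, -, hj, hne⟩ := hu.exists_H3
    have hb := abs_sineCoeff_im_le (H3.toL2 ψ)
    obtain ⟨L, hL1, hL2⟩ := exists_functional (hzero _) (rapid_decay hj hb)
    rw [topologicalClosure_sineSpanH3 (hzero _) hj hb hne hL1 hL2]
    -- A nonzero functional is onto, so the quotient by its kernel is a copy of `ℝ`.
    have hsurj : Function.Surjective (L : H3 →ₗ[ℝ] ℝ) := by
      obtain ⟨j, hj⟩ := hne
      refine LinearMap.surjective fun h => hj ?_
      rw [← hL2 j]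
      exact LinearMap.congr_fun h _
    rw [((L : H3 →ₗ[ℝ] ℝ).quotKerEquivOfSurjective hsurj).finrank_eq, Module.finrank_self]
  · have : (1 : ℕ∞) ≤ k := by rw [← hk.2]; exact le_add_self
    exact_mod_cast this
  · obtain ⟨ψ, hψ, hre, hj, hne⟩ := hu.exists_H3
    refine ⟨ψ, hψ, Set.ext fun z => ?_⟩
    rw [Set.mem_ofPred_eq, forall_l2Inner_eq_zero_iff, SetLike.mem_coe,
      Submodule.mem_span_singleton]
    constructor
    · rintro ⟨h1, h2⟩
      -- The imaginary parts for `z` solve the same recurrence as those for `ψ`; the real parts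
      -- vanish for both, so all coefficients are proportional.
      obtain ⟨t, ht⟩ := solution_proportional (hzero _) hj (abs_sineCoeff_im_le _) (hzero _) h2
        (abs_sineCoeff_im_le _) hne
      refine ⟨t, H3.ext_toL2 (eq_of_sineCoeff_eq fun j => ?_)⟩
      have e : sineCoeff j (H3.toL2 (t • ψ)) = t * sineCoeff j (H3.toL2 ψ) := by
        rw [map_smul, ← sineCoeff_smul]; rfl
      rw [e]
      refine Complex.ext ?_ ?_
      · simp [hre, h1]
      · simpa using (ht j).symm
    · rintro ⟨t, rfl⟩
      rw [← forall_l2Inner_eq_zero_iff]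
      intro h hh
      have h0 := (forall_l2Inner_eq_zero_iff (κ := κ) (H3.toL2 ψ)).2 ⟨hre, hj⟩ h hh
      have e : inner ℂ (H3.toL2 h) (H3.toL2 (t • ψ)) =
          (t : ℂ) * inner ℂ (H3.toL2 h) (H3.toL2 ψ) := by
        rw [map_smul, ← inner_smul_right]; rfl
      rw [l2Inner] at h0 ⊢
      rw [e, Complex.re_ofReal_mul, h0, mul_zero]
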